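/- Let $n>2$, $s\in(0,1)$, and let $\Omega\subset\mathbb R^n$ be bounded and open. Let $K:\mathbb R^n\setminus\{0\}\to[0,\infty)$ be even, with $\min\{|x|^2,1\}K\in L^1(\mathbb R^n)$ and, for some $\lambda>0$, $K(x)\ge\lambda|x|^{-(n+2s)}$ for all $x\ne0$. Put $Q=\mathbb R^{2n}\setminus((\mathbb R^n\setminus\Omega)\times(\mathbb R^n\setminus\Omega))$. Let $\widetilde X$ be the space of measurable $u:\mathbb R^n\to\mathbb R$ with $u=0$ on $\mathbb R^n\setminus\Omega$, $u|_\Omega\in L^2(\Omega)$ and $\iint_Q K(x-y)|u(x)-u(y)|^2\,dx\,dy<\infty$, with the norm $\|u\|_{L^2(\Omega)}+\big(\iint_Q K(x-y)|u(x)-u(y)|^2\,dx\,dy\big)^{1/2}$. Fix $a_1,a_2>0$, $\mu>2$, $r\in(n+1,\infty)$, $q\in\big(2,\tfrac{2n}{n-2s}\big)$ and $C:(0,\infty)\to(0,\infty)$. Let $Z_{\mathrm{ad}}$ be the set of all $g:\Omega\times\mathbb R\to\mathbb R$ such that (A1) $\|g\|_{W^{1,r}(\Omega\times(-M,M))}\le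 C(M)$ for all $M>0$, where $\|g\|_{W^{1,r}}=\|g\|_{L^r}+\|\nabla g\|_{L^r}$ and $g$ denotes the continuous representative on $\Omega\times\mathbb R$; (A2) $|g(x,t)|\le a_1+a_2|t|^{q-1}$ for all $x\in\Omega$, $t\in\mathbb R$; (A3) $g(x,t)/t\to0$ as $t\to0$, uniformly in $x\in\Omega$; (A4) with $G(x,t)=\int_0^t g(x,\tau)\,d\tau$, there is $\omega>0$ such that $0<\mu G(x,t)\le t\,g(x,t)$ for all $x\in\Omega$ and $|t|\ge\omega$. Call $u\in\widetilde X$ a weak solution of $-\mathcal L_Ku=g(x,u)$ if for all $v\in\widetilde X$ $$\iint_{\mathbb R^{2n}}K(x-y)(u(x)-u(y))(v(x)-v(y))\,dx\,dy=\int_\Omega g(x,u(x))v(x)\,dx,$$ and let $\mathcal A$ be the set of pairs $(u,g)\in\widetilde X\times Z_{\mathrm{ad}}$ such that $u$ is a weak solution of $-\mathcal L_Ku=g(x,u)$. **Lemma.** Let $(u_k,g_k)\in\mathcal A$ for all $k$, let $g:\Omega\times\mathbb R\to\mathbb R$ be such that $g_k\to g$ uniformly on $\Omega\times(-M,M)$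 for every $M>0$, and let $u_k\rightharpoonup u$ weakly in $\widetilde X$ with $u\in\widetilde X$. Then $u$ is a weak solution of $-\mathcal L_Ku=g(x,u)$, where for every $v\in\widetilde X$ both integrals in the weak formulation converge absolutely. Moreover $g$ satisfies (A1) and (A2), and hence $(u,g)\in\mathcal A$ provided that $g$ satisfies (A3) and (A4). -/

import Mathlib

open MeasureTheory Set Filter Topology
open scoped ContDiff ENNReal

noncomputable section

namespace FracControl

/-- The Euclidean space `ℝⁿ`. -/
abbrev Rn (n : ℕ) : Type := EuclideanSpace ℝ (Fin n)

/-- The assumptions on the kernel `K : ℝⁿ \ {0} → [0, ∞)` of fractional order `s`.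
The value `K 0` plays no role. -/
structure IsKernel {n : ℕ} (s : ℝ) (K : Rn n → ℝ) : Prop where
  nonneg : ∀ x, x ≠ 0 → 0 ≤ K x
  integrable : Integrable (fun x => min (‖x‖ ^ 2) 1 * K x)
  lower : ∃ c : ℝ, 0 < c ∧ ∀ x, x ≠ 0 → c * ‖x‖ ^ (-((n : ℝ) + 2 * s)) ≤ K x
  even : ∀ x, x ≠ 0 → K (-x) = K x

/-- `Q = (ℝⁿ × ℝⁿ) \ (Ωᶜ × Ωᶜ)`. -/
def Q {n : ℕ} (Ω : Set (Rn n)) : Set (Rn n × Rn n) := (Ωᶜ ×ˢ Ωᶜ)ᶜ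

/-- Membership in `X(Ω)`: Lebesgue measurable functions `u` on `ℝⁿ` with `u|_Ω ∈ L²(Ω)` and
`∬_Q K(x - y) |u(x) - u(y)|² dx dy < ∞`. -/
structure MemX {n : ℕ} (K : Rn n → ℝ) (Ω : Set (Rn n)) (u : Rn n → ℝ) : Prop where
  aestronglyMeasurable : AEStronglyMeasurable u volume
  memLp : MemLp u 2 (volume.restrict Ω)
  integrableOn : IntegrableOn (fun p : Rn n × Rn n => K (p.1 - p.2) * (u p.1 - u p.2) ^ 2) (Q Ω)

/-- The norm of `X(Ω)`, `‖u‖_{L²(Ω)} + (∬_Q K(x - y) |u(x) - u(y)|² dx dy)^{1/2}`. -/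
def normX {n : ℕ} (K : Rn n → ℝ) (Ω : Set (Rn n)) (u : Rn n → ℝ) : ℝ :=
  Real.sqrt (∫ x in Ω, u x ^ 2) +
    Real.sqrt (∫ p in Q Ω, K (p.1 - p.2) * (u p.1 - u p.2) ^ 2)

theorem IsKernel.aestronglyMeasurable {n : ℕ} {s : ℝ} {K : Rn n → ℝ} (hK : IsKernel s K) :
    ∃ K' : Rn n → ℝ, AEStronglyMeasurable K' volume ∧ ∀ x, x ≠ 0 → K' x = K x := by
  refine ⟨fun x => (min (‖x‖ ^ 2) 1)⁻¹ * (min (‖x‖ ^ 2) 1 * K x), ?_, ?_⟩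
  · refine AEStronglyMeasurable.mul ?_ hK.integrable.1
    exact Measurable.aestronglyMeasurable (by fun_prop)
  · intro x hx
    have h1 : 0 < ‖x‖ := norm_pos_iff.2 hx
    have h2 : 0 < min (‖x‖ ^ 2) 1 := lt_min (by positivity) one_pos
    field_simp

theorem IsKernel.integrand_aestronglyMeasurable {n : ℕ} {s : ℝ} {K : Rn n → ℝ}
    (hK : IsKernel s K) {u : Rn n → ℝ} (hu : AEStronglyMeasurable u volume) :
    AEStronglyMeasurable (fun p : Rn n × Rn n => K (p.1 - p.2) * (u p.1 - u p.2) ^ 2) volume := by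
  obtain ⟨K', hm, hK'⟩ := hK.aestronglyMeasurable
  have h : (fun p : Rn n × Rn n => K (p.1 - p.2) * (u p.1 - u p.2) ^ 2) =
      fun p : Rn n × Rn n => K' (p.1 - p.2) * (u p.1 - u p.2) ^ 2 := by
    funext p
    by_cases hp : p.1 = p.2
    · simp [hp]
    · rw [hK' _ (sub_ne_zero.2 hp)]
  rw [h]
  have h1 : AEStronglyMeasurable (fun p : Rn n × Rn n => K' (p.1 - p.2)) volume :=
    hm.comp_quasiMeasurePreserving (quasiMeasurePreserving_sub volume volume)
  have h2 : AEStronglyMeasurable (fun p : Rn n × Rn n => u p.1) volume :=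
    hu.comp_quasiMeasurePreserving Measure.quasiMeasurePreserving_fst
  have h3 : AEStronglyMeasurable (fun p : Rn n × Rn n => u p.2) volume :=
    hu.comp_quasiMeasurePreserving Measure.quasiMeasurePreserving_snd
  exact h1.mul ((h2.sub h3).pow 2)

theorem MemX.add {n : ℕ} {s : ℝ} {K : Rn n → ℝ} (hK : IsKernel s K) {Ω : Set (Rn n)}
    {u v : Rn n → ℝ} (hu : MemX K Ω u) (hv : MemX K Ω v) : MemX K Ω (u + v) := by
  refine ⟨hu.1.add hv.1, hu.2.add hv.2, ?_⟩
  refine Integrable.mono' ((hu.3.const_mul 2).add (hv.3.const_mul 2))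
    (hK.integrand_aestronglyMeasurable (hu.1.add hv.1)).restrict (Eventually.of_forall ?_)
  intro p
  by_cases hp : p.1 = p.2
  · simp [hp]
  · have h := hK.nonneg _ (sub_ne_zero.2 hp)
    simp only [Pi.add_apply]
    rw [Real.norm_of_nonneg (by positivity)]
    nlinarith [mul_nonneg h (sq_nonneg ((u p.1 - u p.2) - (v p.1 - v p.2)))]

theorem MemX.smul {n : ℕ} {K : Rn n → ℝ} {Ω : Set (Rn n)}
    {u : Rn n → ℝ} (c : ℝ) (hu : MemX K Ω u) : MemX K Ω (c • u) := by
  refine ⟨hu.1.const_smul c, hu.2.const_smul c, ?_⟩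
  refine (hu.3.const_mul (c ^ 2)).congr (Eventually.of_forall fun p => ?_)
  simp only [Pi.smul_apply, smul_eq_mul]
  ring

theorem MemX.zero {n : ℕ} {K : Rn n → ℝ} {Ω : Set (Rn n)} : MemX K Ω 0 := by
  refine ⟨aestronglyMeasurable_zero, MemLp.zero, ?_⟩
  simp [IntegrableOn]

/-- The space `X̃(ℝⁿ)` of all `u ∈ X(Ω)` that vanish on `ℝⁿ \ Ω`. -/
def XTilde {n : ℕ} {s : ℝ} {K : Rn n → ℝ} (hK : IsKernel s K) (Ω : Set (Rn n)) :
    Submodule ℝ (Rn n → ℝ) where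
  carrier := {u | MemX K Ω u ∧ ∀ x, x ∉ Ω → u x = 0}
  add_mem' hu hv := ⟨hu.1.add hK hv.1, fun x hx => by simp [hu.2 x hx, hv.2 x hx]⟩
  zero_mem' := ⟨MemX.zero, fun _ _ => rfl⟩
  smul_mem' c _ hu := ⟨hu.1.smul c, fun x hx => by simp [hu.2 x hx]⟩

/-- Weak convergence in `X̃(ℝⁿ)`: convergence against every linear functional on `X̃(ℝⁿ)` which is
bounded with respect to the norm of `X(Ω)`. -/
def WeaklyConverges {n : ℕ} {s : ℝ} {K : Rn n → ℝ} (hK : IsKernel s K) (Ω : Set (Rn n))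
    (u : ℕ → XTilde hK Ω) (u₀ : XTilde hK Ω) : Prop :=
  ∀ l : XTilde hK Ω →ₗ[ℝ] ℝ,
    (∃ c : ℝ, ∀ w : XTilde hK Ω, |l w| ≤ c * normX K Ω (w : Rn n → ℝ)) →
      Tendsto (fun k => l (u k)) atTop (𝓝 (l u₀))

/-- `D` is a weak gradient of `f` on the open set `V ⊆ ℝⁿ × ℝ` (the target of `D` is `ℝⁿ × ℝ` with
its Euclidean norm). -/
def IsWeakGradient {n : ℕ} (V : Set (Rn n × ℝ)) (f : Rn n × ℝ → ℝ)
    (D : Rn n × ℝ → WithLp 2 (Rn n × ℝ)) : Prop :=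
  ∀ φ : Rn n × ℝ → ℝ, ContDiff ℝ ∞ φ → HasCompactSupport φ → tsupport φ ⊆ V →
    ∀ e : WithLp 2 (Rn n × ℝ),
      ∫ p in V, f p * fderiv ℝ φ p (WithLp.ofLp e) = -∫ p in V, inner ℝ (D p) e * φ p

/-- `f ∈ W^{1,r}(V)` and `‖f‖_{W^{1,r}(V)} = ‖f‖_{L^r(V)} + ‖∇f‖_{L^r(V)} ≤ c`. -/
def SobolevNormLE {n : ℕ} (V : Set (Rn n × ℝ)) (r : ℝ) (f : Rn n × ℝ → ℝ) (c : ℝ) : Prop :=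
  MemLp f (ENNReal.ofReal r) (volume.restrict V) ∧
    ∃ D : Rn n × ℝ → WithLp 2 (Rn n × ℝ),
      MemLp D (ENNReal.ofReal r) (volume.restrict V) ∧ IsWeakGradient V f D ∧
        eLpNorm f (ENNReal.ofReal r) (volume.restrict V) +
          eLpNorm D (ENNReal.ofReal r) (volume.restrict V) ≤ ENNReal.ofReal c

/-- The Sobolev bound on a control. As `r > n + 1`, a function which is `W^{1,r}` on all sets
`Ω × (-M, M)` is identified with its continuous representative on `Ω × ℝ`. -/
structure SobolevBound {n : ℕ} (Ω : Set (Rn n)) (r : ℝ) (C : ℝ → ℝ) (g : Rn n → ℝ → ℝ) :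
    Prop where
  continuousOn : ContinuousOn (fun p : Rn n × ℝ => g p.1 p.2) (Ω ×ˢ univ)
  norm_le : ∀ M : ℝ, 0 < M →
    SobolevNormLE (Ω ×ˢ Ioo (-M) M) r (fun p => g p.1 p.2) (C M)

/-- The growth bound `|g(x, t)| ≤ a₁ + a₂ |t|^{q-1}`. -/
def GrowthBound {n : ℕ} (Ω : Set (Rn n)) (a₁ a₂ q : ℝ) (g : Rn n → ℝ → ℝ) : Prop :=
  ∀ x ∈ Ω, ∀ t : ℝ, |g x t| ≤ a₁ + a₂ * |t| ^ (q - 1)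

/-- `g(x, t) / t → 0` as `t → 0`, uniformly over `x ∈ Ω`. -/
def SuperlinearAtZero {n : ℕ} (Ω : Set (Rn n)) (g : Rn n → ℝ → ℝ) : Prop :=
  ∀ ε : ℝ, 0 < ε → ∃ δ : ℝ, 0 < δ ∧ ∀ x ∈ Ω, ∀ t : ℝ, t ≠ 0 → |t| < δ → |g x t / t| < ε

/-- The Ambrosetti-Rabinowitz condition: with `G(x, t) = ∫_0^t g(x, τ) dτ` there is `T > 0` such
that `0 < μ G(x, t) ≤ t g(x, t)` for all `x ∈ Ω` and `|t| ≥ T`. -/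
def AmbrosettiRabinowitz {n : ℕ} (Ω : Set (Rn n)) (μ : ℝ) (g : Rn n → ℝ → ℝ) : Prop :=
  ∃ T : ℝ, 0 < T ∧ ∀ x ∈ Ω, ∀ t : ℝ, T ≤ |t| →
    0 < μ * (∫ τ in (0 : ℝ)..t, g x τ) ∧ μ * (∫ τ in (0 : ℝ)..t, g x τ) ≤ t * g x t

/-- The admissible set of controls. Only the values of `g` on `Ω × ℝ` play a role. -/
def Zad {n : ℕ} (Ω : Set (Rn n)) (a₁ a₂ μ r q : ℝ) (C : ℝ → ℝ) : Set (Rn n → ℝ → ℝ) :=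
  {g | SobolevBound Ω r C g ∧ GrowthBound Ω a₁ a₂ q g ∧ SuperlinearAtZero Ω g ∧
    AmbrosettiRabinowitz Ω μ g}

/-- The derivative of the energy in the direction `v`,
`∬_{ℝ²ⁿ} K(x - y) (u(x) - u(y)) (v(x) - v(y)) dx dy - ∫_Ω g(x, u(x)) v(x) dx`. -/
def energyDeriv {n : ℕ} (K : Rn n → ℝ) (Ω : Set (Rn n)) (g : Rn n → ℝ → ℝ) (u v : Rn n → ℝ) : ℝ :=
  (∫ p : Rn n × Rn n, K (p.1 - p.2) * (u p.1 - u p.2) * (v p.1 - v p.2)) -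
    ∫ x in Ω, g x (u x) * v x

/-- The set `𝒜` of pairs `(u, g) ∈ X̃(ℝⁿ) × Z_ad` such that `u` is a weak solution of the state
equation with nonlinearity `g`. -/
def admissiblePairs {n : ℕ} {s : ℝ} {K : Rn n → ℝ} (hK : IsKernel s K) (Ω : Set (Rn n))
    (a₁ a₂ μ r q : ℝ) (C : ℝ → ℝ) : Set (XTilde hK Ω × (Rn n → ℝ → ℝ)) :=
  {z | z.2 ∈ Zad Ω a₁ a₂ μ r q C ∧ ∀ v : XTilde hK Ω, energyDeriv K Ω z.2 z.1 v = 0}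

end FracControl

end

open FracControl

/-!
The bilinear form of the weak formulation is the inner product of the jumps
`K(x - y)^{1/2} (u(x) - u(y))` in `L²(ℝⁿ × ℝⁿ)`. For a fixed test function it is a bounded linear
functional of `u`, so it converges along the weakly convergent sequence `u_k`. What remains is to
pass to the limit in `∫ g_k(x, u_k) v` and to show that the bounds on the controls are stable.

*The nonlinear term.* By the uniform boundedness principle the energies of `u_k` are bounded
(`WeaklyConverges.exists_norm_le`). The kernel dominates a multiple of `|x - y|^{-(n + 2s)}`, so the
Gagliardo energies are bounded too, and two facts follow.

* `u_k` is bounded in `L^q(Ω)`. If `a(t)` is the measure of `{t ≤ |u|}`, a ball of measure `2 a(t)`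
  around a point of `{2t ≤ |u|}` contains a set of measure at least `a(t)` on which the jump exceeds
  `t`. This yields `a(2t) t² ≤ D a(t)^{2s/n}` (`exists_measure_levelSet_le`), and iteration over
  dyadic `t` gives decay of `a` with the critical exponent `2n / (n - 2s)`
  (`exists_geometric_bound`, `exists_lintegral_rpow_le`).
* `u_k → u` in `L¹(Ω)`. Up to an error of order `ε^s` a function of bounded Gagliardo energy is
  controlled by its averages over balls of radius `ε` (`lintegral_enorm_le`), and for `u_k - u`
  these tend to zero by weak convergence (`WeaklyConverges.tendsto_lintegral_enorm`).

Along a subsequence `u_k → u` almost everywhere, hence `g_k(x, u_k) → g(x, u)`. By the growth bound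
`g_k(x, u_k)` is bounded in `L^{q/(q-1)}(Ω)`, so its products with `v ∈ L^q(Ω)` are uniformly
integrable, and Vitali's theorem applies (`tendsto_integral_comp_mul`).

*The controls.* The growth bound passes to the limit pointwise. For the Sobolev bound, the gradients
of those functions in the Sobolev ball that lie uniformly within `1 / (m + 1)` of `g` form a
decreasing sequence of convex sets, bounded in `L²`. Elements of almost minimal norm converge in `L²`
(`exists_tendsto_of_antitone_convex`); the limit is the weak gradient of `g`, and Fatou's lemma
bounds its `L^r` norm (`SobolevNormLE.of_tendstoUniformlyOn`).
-/

open MeasureTheory Set Filter Topology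
open scoped ContDiff ENNReal

namespace FracControl

/-! ### Convergent selections from convex sets -/

/-- A decreasing sequence of nonempty convex sets in a bounded part of a Hilbert space admits
a convergent selection. The points selected almost minimize the norm in their set, so that the
parallelogram identity makes them a Cauchy sequence. -/
theorem exists_tendsto_of_antitone_convex {H : Type*} [NormedAddCommGroup H]
    [InnerProductSpace ℝ H] [CompleteSpace H] {A : ℕ → Set H} (hA : Antitone A)
    (hconv : ∀ m, Convex ℝ (A m)) (hne : ∀ m, (A m).Nonempty) {R : ℝ}
    (hR : ∀ m, ∀ x ∈ A m, ‖x‖ ≤ R) :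
    ∃ (E : ℕ → H) (D : H), (∀ m, E m ∈ A m) ∧ Tendsto E atTop (𝓝 D) := by
  set δ : ℕ → ℝ := fun m => sInf ((fun x : H => ‖x‖ ^ 2) '' A m) with hδ
  have hbdd : ∀ m, BddBelow ((fun x : H => ‖x‖ ^ 2) '' A m) := fun m =>
    ⟨0, by rintro _ ⟨x, -, rfl⟩; positivity⟩
  have hle : ∀ m, ∀ x ∈ A m, δ m ≤ ‖x‖ ^ 2 := fun m x hx =>
    csInf_le (hbdd m) (mem_image_of_mem _ hx)
  have hmono : Monotone δ := fun m l hml =>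
    csInf_le_csInf (hbdd m) ((hne l).image _) (image_mono (hA hml))
  have hδR : BddAbove (range δ) := by
    refine ⟨R ^ 2, ?_⟩
    rintro _ ⟨m, rfl⟩
    obtain ⟨x, hx⟩ := hne m
    exact (hle m x hx).trans (pow_le_pow_left₀ (norm_nonneg _) (hR m x hx) 2)
  have hex : ∀ m : ℕ, ∃ x ∈ A m, ‖x‖ ^ 2 < δ m + 1 / ((m : ℝ) + 1) := by
    intro m
    obtain ⟨_, ⟨x, hx, rfl⟩, h⟩ := exists_lt_of_csInf_lt ((hne m).image (fun x : H => ‖x‖ ^ 2))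
      (show δ m < δ m + 1 / ((m : ℝ) + 1) by
        have : 0 < 1 / ((m : ℝ) + 1) := by positivity
        linarith)
    exact ⟨x, hx, h⟩
  choose E hE hEδ using hex
  have hlim : Tendsto δ atTop (𝓝 (⨆ m, δ m)) := tendsto_atTop_ciSup hmono hδR
  have hb : Tendsto (fun m : ℕ => Real.sqrt (4 * ((⨆ m, δ m) - δ m) + 4 * (1 / ((m : ℝ) + 1))))
      atTop (𝓝 0) := by
    have h := ((hlim.const_sub (⨆ m, δ m)).const_mul 4).add
      ((tendsto_one_div_add_atTop_nhds_zero_nat (𝕜 := ℝ)).const_mul 4)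
    simpa using h.sqrt
  have hcau : CauchySeq E := by
    refine cauchySeq_of_le_tendsto_0 _ (fun m l N hm hl => ?_) hb
    rw [dist_eq_norm]
    refine Real.le_sqrt_of_sq_le ?_
    have hmid := hle N _ (hconv N (hA hm (hE m)) (hA hl (hE l)) (by norm_num : (0 : ℝ) ≤ 1 / 2)
      (by norm_num : (0 : ℝ) ≤ 1 / 2) (by norm_num))
    rw [← smul_add, norm_smul, mul_pow] at hmid
    have hpar := parallelogram_law_with_norm ℝ (E m) (E l)
    have h1 : 1 / ((m : ℝ) + 1) ≤ 1 / ((N : ℝ) + 1) :=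
      one_div_le_one_div_of_le (by positivity) (by exact_mod_cast Nat.succ_le_succ hm)
    have h2 : 1 / ((l : ℝ) + 1) ≤ 1 / ((N : ℝ) + 1) :=
      one_div_le_one_div_of_le (by positivity) (by exact_mod_cast Nat.succ_le_succ hl)
    have h3 := hEδ m
    have h4 := hEδ l
    have h5 : δ m ≤ ⨆ m, δ m := le_ciSup hδR m
    have h6 : δ l ≤ ⨆ m, δ m := le_ciSup hδR l
    rw [Real.norm_of_nonneg (by norm_num : (0 : ℝ) ≤ 1 / 2)] at hmid
    have h7 : δ N ≤ ⨆ m, δ m := le_ciSup hδR N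
    have h8 := hmono hm
    have h9 := hmono hl
    linarith
  obtain ⟨D, hD⟩ := cauchySeq_tendsto_of_complete hcau
  exact ⟨E, D, hE, hD⟩

theorem liminf_add_liminf_le (a b : ℕ → ℝ≥0∞) :
    liminf a atTop + liminf b atTop ≤ liminf (fun k => a k + b k) atTop := by
  simp only [liminf_eq_iSup_iInf_of_nat]
  rw [ENNReal.iSup_add_iSup_of_monotone]
  · refine iSup_mono fun k => le_iInf₂ fun i hi => ?_
    exact add_le_add (iInf₂_le i hi) (iInf₂_le i hi)
  · exact fun k l hkl => le_iInf₂ fun i hi => iInf₂_le i (hkl.trans hi)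
  · exact fun k l hkl => le_iInf₂ fun i hi => iInf₂_le i (hkl.trans hi)

/-! ### Weak gradients and closedness of Sobolev balls -/

section Sobolev

variable {n : ℕ} {V : Set (Rn n × ℝ)}

theorem exists_bound_fderiv_apply {φ : Rn n × ℝ → ℝ} (hφ : ContDiff ℝ ∞ φ)
    (hc : HasCompactSupport φ) (e : Rn n × ℝ) :
    Continuous (fun p => fderiv ℝ φ p e) ∧ ∃ B, ∀ p, ‖fderiv ℝ φ p e‖ ≤ B := by
  have h1 : Continuous (fun p => fderiv ℝ φ p e) :=
    (hφ.continuous_fderiv (by simp)).clm_apply continuous_const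
  exact ⟨h1, h1.bounded_above_of_compact_support (hc.fderiv_apply (𝕜 := ℝ) e)⟩

theorem integrable_mul_fderiv {φ : Rn n × ℝ → ℝ} (hφ : ContDiff ℝ ∞ φ)
    (hc : HasCompactSupport φ) (e : Rn n × ℝ) {f : Rn n × ℝ → ℝ}
    (hf : IntegrableOn f V) : IntegrableOn (fun p => f p * fderiv ℝ φ p e) V := by
  obtain ⟨h1, B, hB⟩ := exists_bound_fderiv_apply hφ hc e
  exact hf.mul_bdd (c := B) h1.aestronglyMeasurable (Eventually.of_forall hB)

theorem integrable_inner_mul {φ : Rn n × ℝ → ℝ} (hφ : ContDiff ℝ ∞ φ)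
    (hc : HasCompactSupport φ) (e : WithLp 2 (Rn n × ℝ)) {D : Rn n × ℝ → WithLp 2 (Rn n × ℝ)}
    (hD : IntegrableOn D V) : IntegrableOn (fun p => inner ℝ (D p) e * φ p) V := by
  obtain ⟨B, hB⟩ := hφ.continuous.bounded_above_of_compact_support hc
  exact (Integrable.inner_const hD e).mul_bdd (c := B) hφ.continuous.aestronglyMeasurable
    (Eventually.of_forall hB)

theorem IsWeakGradient.congr {f : Rn n × ℝ → ℝ} {D D' : Rn n × ℝ → WithLp 2 (Rn n × ℝ)}
    (h : IsWeakGradient V f D) (hD : D =ᵐ[volume.restrict V] D') : IsWeakGradient V f D' := by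
  intro φ hφ hc hs e
  rw [h φ hφ hc hs e]
  congr 1
  refine integral_congr_ae ?_
  filter_upwards [hD] with p hp
  rw [hp]

theorem IsWeakGradient.linear_comb {f₁ f₂ : Rn n × ℝ → ℝ}
    {D₁ D₂ : Rn n × ℝ → WithLp 2 (Rn n × ℝ)}
    (h₁ : IsWeakGradient V f₁ D₁) (h₂ : IsWeakGradient V f₂ D₂)
    (hf₁ : IntegrableOn f₁ V) (hf₂ : IntegrableOn f₂ V)
    (hD₁ : IntegrableOn D₁ V) (hD₂ : IntegrableOn D₂ V) (a b : ℝ) :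
    IsWeakGradient V (a • f₁ + b • f₂) (a • D₁ + b • D₂) := by
  intro φ hφ hc hs e
  have e1 : (fun p => (a • f₁ + b • f₂) p * fderiv ℝ φ p (WithLp.ofLp e)) =
      fun p => a * (f₁ p * fderiv ℝ φ p (WithLp.ofLp e)) +
        b * (f₂ p * fderiv ℝ φ p (WithLp.ofLp e)) := by
    funext p; simp; ring
  have e2 : (fun p => inner ℝ ((a • D₁ + b • D₂) p) e * φ p) =
      fun p => a * (inner ℝ (D₁ p) e * φ p) + b * (inner ℝ (D₂ p) e * φ p) := by
    funext p
    simp only [Pi.add_apply, Pi.smul_apply, inner_add_left, real_inner_smul_left]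
    ring
  rw [e1, e2, integral_add ((integrable_mul_fderiv hφ hc _ hf₁).const_mul a)
    ((integrable_mul_fderiv hφ hc _ hf₂).const_mul b),
    integral_add ((integrable_inner_mul hφ hc e hD₁).const_mul a)
    ((integrable_inner_mul hφ hc e hD₂).const_mul b)]
  simp only [integral_const_mul]
  rw [h₁ φ hφ hc hs e, h₂ φ hφ hc hs e]
  ring

/-- Weak gradients pass to limits in `L¹`. -/
theorem IsWeakGradient.of_tendsto {f : ℕ → Rn n × ℝ → ℝ} {f₀ : Rn n × ℝ → ℝ}
    {D : ℕ → Rn n × ℝ → WithLp 2 (Rn n × ℝ)} {D₀ : Rn n × ℝ → WithLp 2 (Rn n × ℝ)}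
    (h : ∀ m, IsWeakGradient V (f m) (D m))
    (hf : ∀ m, IntegrableOn (f m) V) (hf₀ : IntegrableOn f₀ V)
    (hD : ∀ m, IntegrableOn (D m) V) (hD₀ : IntegrableOn D₀ V)
    (hft : Tendsto (fun m => ∫⁻ p in V, ‖f m p - f₀ p‖ₑ) atTop (𝓝 0))
    (hDt : Tendsto (fun m => ∫⁻ p in V, ‖D m p - D₀ p‖ₑ) atTop (𝓝 0)) :
    IsWeakGradient V f₀ D₀ := by
  intro φ hφ hc hs e
  have h1 : Tendsto (fun m => ∫ p in V, f m p * fderiv ℝ φ p (WithLp.ofLp e)) atTop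
      (𝓝 (∫ p in V, f₀ p * fderiv ℝ φ p (WithLp.ofLp e))) := by
    obtain ⟨-, B, hB⟩ := exists_bound_fderiv_apply hφ hc (WithLp.ofLp e)
    refine tendsto_integral_of_L1 _ (integrable_mul_fderiv hφ hc _ hf₀).1
      (Eventually.of_forall fun m => integrable_mul_fderiv hφ hc _ (hf m)) ?_
    have h0 := ENNReal.Tendsto.mul_const (b := ENNReal.ofReal B) hft (Or.inr ENNReal.ofReal_ne_top)
    rw [zero_mul] at h0
    refine tendsto_of_tendsto_of_tendsto_of_le_of_le tendsto_const_nhds h0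
      (fun _ => zero_le) (fun m => ?_)
    rw [← lintegral_mul_const' _ _ ENNReal.ofReal_ne_top]
    refine lintegral_mono fun p => ?_
    rw [← sub_mul, enorm_mul]
    gcongr
    rw [← ofReal_norm]
    exact ENNReal.ofReal_le_ofReal (hB p)
  have h2 : Tendsto (fun m => ∫ p in V, inner ℝ (D m p) e * φ p) atTop
      (𝓝 (∫ p in V, inner ℝ (D₀ p) e * φ p)) := by
    obtain ⟨B, hB⟩ := hφ.continuous.bounded_above_of_compact_support hc
    refine tendsto_integral_of_L1 _ (integrable_inner_mul hφ hc _ hD₀).1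
      (Eventually.of_forall fun m => integrable_inner_mul hφ hc _ (hD m)) ?_
    have h0 := ENNReal.Tendsto.mul_const (b := ENNReal.ofReal (‖e‖ * B)) hDt
      (Or.inr ENNReal.ofReal_ne_top)
    rw [zero_mul] at h0
    refine tendsto_of_tendsto_of_tendsto_of_le_of_le tendsto_const_nhds h0
      (fun _ => zero_le) (fun m => ?_)
    rw [← lintegral_mul_const' _ _ ENNReal.ofReal_ne_top]
    refine lintegral_mono fun p => ?_
    rw [← sub_mul, ← inner_sub_left, ← ofReal_norm, ← ofReal_norm,
      ← ENNReal.ofReal_mul (norm_nonneg _)]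
    refine ENNReal.ofReal_le_ofReal ?_
    rw [norm_mul, ← mul_assoc]
    gcongr
    · exact norm_inner_le_norm _ _
    · exact hB p
  have h3 := h2.neg
  simp only [← h _ φ hφ hc hs e] at h3
  exact tendsto_nhds_unique h1 h3

/-- The Sobolev ball of radius `c` in `W^{1,r}(V)` is closed under uniform convergence. The
gradients need only converge weakly, but suitable convex combinations of them converge in `L²`,
and Fatou's lemma gives the norm bound. -/
theorem SobolevNormLE.of_tendstoUniformlyOn {r : ℝ} (hr : 2 ≤ r) (hV : MeasurableSet V)
    (hVf : volume V ≠ ⊤) {f : ℕ → Rn n × ℝ → ℝ} {f₀ : Rn n × ℝ → ℝ} {c : ℝ}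
    (hf : ∀ k, SobolevNormLE V r (f k) c) (hf₀ : AEStronglyMeasurable f₀ (volume.restrict V))
    (hlim : TendstoUniformlyOn f f₀ atTop V) : SobolevNormLE V r f₀ c := by
  have : IsFiniteMeasure (volume.restrict V) := ⟨by simpa using hVf.lt_top⟩
  set ρ := ENNReal.ofReal r with hρ
  have h2ρ : (2 : ℝ≥0∞) ≤ ρ := by
    rw [hρ, ← ENNReal.ofReal_ofNat]
    exact ENNReal.ofReal_le_ofReal hr
  have h1ρ : (1 : ℝ≥0∞) ≤ ρ := one_le_two.trans h2ρ
  -- gradients of Sobolev functions in the ball that are uniformly close to the limit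
  let A : ℕ → Set (Lp (WithLp 2 (Rn n × ℝ)) 2 (volume.restrict V)) := fun m =>
    {E | ∃ h : Rn n × ℝ → ℝ, MemLp h ρ (volume.restrict V) ∧ MemLp E ρ (volume.restrict V) ∧
      IsWeakGradient V h E ∧
      eLpNorm h ρ (volume.restrict V) + eLpNorm E ρ (volume.restrict V) ≤ ENNReal.ofReal c ∧
      ∀ p ∈ V, |h p - f₀ p| ≤ 1 / ((m : ℝ) + 1)}
  have hA : Antitone A := by
    rintro m l hml E ⟨h, h1, h2, h3, h4, h5⟩
    refine ⟨h, h1, h2, h3, h4, fun p hp => (h5 p hp).trans ?_⟩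
    exact one_div_le_one_div_of_le (by positivity) (by exact_mod_cast Nat.succ_le_succ hml)
  have hconv : ∀ m, Convex ℝ (A m) := by
    rintro m E₁ ⟨h, h1, h2, h3, h4, h5⟩ E₂ ⟨k, k1, k2, k3, k4, k5⟩ a b ha hb hab
    have hae : (a • (E₁ : Rn n × ℝ → WithLp 2 (Rn n × ℝ)) + b • (E₂ : Rn n × ℝ → _))
        =ᵐ[volume.restrict V] (a • E₁ + b • E₂ : Lp _ 2 (volume.restrict V)) := by
      filter_upwards [Lp.coeFn_add (a • E₁) (b • E₂), Lp.coeFn_smul a E₁, Lp.coeFn_smul b E₂]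
        with p q1 q2 q3
      rw [q1]
      simp only [Pi.add_apply, q2, q3]
    refine ⟨a • h + b • k, (h1.const_smul a).add (k1.const_smul b), ?_, ?_, ?_, ?_⟩
    · exact ((h2.const_smul a).add (k2.const_smul b)).ae_eq hae
    · exact (h3.linear_comb k3 (h1.integrable h1ρ) (k1.integrable h1ρ) (h2.integrable h1ρ)
        (k2.integrable h1ρ) a b).congr hae
    · rw [← eLpNorm_congr_ae hae]
      have q1 := eLpNorm_add_le (h1.const_smul a).1 (k1.const_smul b).1 h1ρ
      have q2 := eLpNorm_add_le (h2.const_smul a).1 (k2.const_smul b).1 h1ρ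
      simp only [eLpNorm_const_smul] at q1 q2
      have hab' : ‖a‖ₑ + ‖b‖ₑ = 1 := by
        rw [Real.enorm_of_nonneg ha, Real.enorm_of_nonneg hb, ← ENNReal.ofReal_add ha hb, hab,
          ENNReal.ofReal_one]
      calc _ ≤ _ := add_le_add q1 q2
        _ = ‖a‖ₑ * (eLpNorm h ρ (volume.restrict V) + eLpNorm E₁ ρ (volume.restrict V)) +
            ‖b‖ₑ * (eLpNorm k ρ (volume.restrict V) + eLpNorm E₂ ρ (volume.restrict V)) := by ring
        _ ≤ ‖a‖ₑ * ENNReal.ofReal c + ‖b‖ₑ * ENNReal.ofReal c := by gcongr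
        _ = ENNReal.ofReal c := by rw [← add_mul, hab', one_mul]
    · intro p hp
      have q : (a • h + b • k) p - f₀ p = a * (h p - f₀ p) + b * (k p - f₀ p) := by
        have : f₀ p = (a + b) * f₀ p := by rw [hab, one_mul]
        simp only [Pi.add_apply, Pi.smul_apply, smul_eq_mul]
        linear_combination -this
      rw [q]
      calc _ ≤ |a * (h p - f₀ p)| + |b * (k p - f₀ p)| := abs_add_le _ _
        _ = a * |h p - f₀ p| + b * |k p - f₀ p| := by
          rw [abs_mul, abs_mul, abs_of_nonneg ha, abs_of_nonneg hb]
        _ ≤ a * (1 / ((m : ℝ) + 1)) + b * (1 / ((m : ℝ) + 1)) := by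
          gcongr
          exacts [h5 p hp, k5 p hp]
        _ = _ := by rw [← add_mul, hab, one_mul]
  have hne : ∀ m, (A m).Nonempty := by
    intro m
    obtain ⟨k, hk⟩ := (Metric.tendstoUniformlyOn_iff.1 hlim (1 / ((m : ℝ) + 1))
      (by positivity)).exists
    obtain ⟨h1, D, hD1, hD2, hD3⟩ := hf k
    have hD : MemLp D 2 (volume.restrict V) := hD1.mono_exponent h2ρ
    refine ⟨hD.toLp, f k, h1, hD1.ae_eq hD.coeFn_toLp.symm, hD2.congr hD.coeFn_toLp.symm, ?_, ?_⟩
    · rwa [eLpNorm_congr_ae hD.coeFn_toLp]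
    · intro p hp
      have := hk p hp
      rw [dist_comm, Real.dist_eq] at this
      exact this.le
  obtain ⟨E, D, hE, hED⟩ : ∃ (E : ℕ → Lp (WithLp 2 (Rn n × ℝ)) 2 (volume.restrict V)) (D : _),
      (∀ m, E m ∈ A m) ∧ Tendsto E atTop (𝓝 D) := by
    refine exists_tendsto_of_antitone_convex hA hconv hne
      (R := (ENNReal.ofReal c * (volume.restrict V) univ ^
        (1 / (2 : ℝ≥0∞).toReal - 1 / ρ.toReal)).toReal) ?_
    rintro m x ⟨h, h1, h2, -, h4, -⟩
    rw [Lp.norm_def]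
    have hexp : 0 ≤ 1 / (2 : ℝ≥0∞).toReal - 1 / ρ.toReal := by
      rw [hρ, ENNReal.toReal_ofReal (by linarith), ENNReal.toReal_ofNat, sub_nonneg]
      exact one_div_le_one_div_of_le two_pos hr
    refine ENNReal.toReal_mono (ENNReal.mul_ne_top ENNReal.ofReal_ne_top
      (ENNReal.rpow_ne_top_of_nonneg hexp (measure_ne_top _ _))) ?_
    refine (eLpNorm_le_eLpNorm_mul_rpow_measure_univ h2ρ h2.1).trans ?_
    gcongr
    exact le_add_self.trans h4
  choose h h1 h2 h3 h4 h5 using hE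
  have hDt : Tendsto (fun m => eLpNorm (fun p => E m p - D p) 2 (volume.restrict V)) atTop
      (𝓝 0) := Lp.tendsto_Lp_iff_tendsto_eLpNorm'' _ (fun m => Lp.memLp (E m)) _ (Lp.memLp D)
        |>.1 (by simpa using hED)
  have hmeas : TendstoInMeasure (volume.restrict V) (fun m p => E m p) atTop D :=
    tendstoInMeasure_of_tendsto_eLpNorm two_ne_zero (fun m => (Lp.memLp (E m)).1)
      (Lp.memLp D).1 hDt
  obtain ⟨ns, hns, hae⟩ := hmeas.exists_seq_tendsto_ae
  have hpt : ∀ p ∈ V, Tendsto (fun m => h m p) atTop (𝓝 (f₀ p)) := by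
    intro p hp
    rw [tendsto_iff_dist_tendsto_zero]
    exact squeeze_zero (fun _ => dist_nonneg) (fun m => h5 m p hp)
      tendsto_one_div_add_atTop_nhds_zero_nat
  have hfatou : eLpNorm f₀ ρ (volume.restrict V) + eLpNorm D ρ (volume.restrict V) ≤
      ENNReal.ofReal c := by
    have q1 := Lp.eLpNorm_lim_le_liminf_eLpNorm (p := ρ) (fun m => (h1 (ns m)).1) f₀
      (by
        filter_upwards [ae_restrict_mem hV] with p hp
        exact (hpt p hp).comp hns.tendsto_atTop)
    have q2 := Lp.eLpNorm_lim_le_liminf_eLpNorm (p := ρ) (fun m => (h2 (ns m)).1) D hae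
    refine (add_le_add q1 q2).trans ?_
    refine (liminf_add_liminf_le _ _).trans (liminf_le_of_le (by isBoundedDefault) ?_)
    intro b hb
    obtain ⟨m, hm⟩ := hb.exists
    exact hm.trans (h4 (ns m))
  have hD' : MemLp D ρ (volume.restrict V) :=
    ⟨(Lp.memLp D).1, (le_add_self.trans hfatou).trans_lt ENNReal.ofReal_lt_top⟩
  have hf₀' : MemLp f₀ ρ (volume.restrict V) :=
    ⟨hf₀, (le_self_add.trans hfatou).trans_lt ENNReal.ofReal_lt_top⟩
  refine ⟨hf₀', D, hD', ?_, hfatou⟩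
  refine IsWeakGradient.of_tendsto h3 (fun m => (h1 m).integrable h1ρ) (hf₀'.integrable h1ρ)
    (fun m => (h2 m).integrable h1ρ) (hD'.integrable h1ρ) ?_ ?_
  · have q0 : Tendsto (fun m : ℕ => ENNReal.ofReal (1 / ((m : ℝ) + 1)) * volume V) atTop
        (𝓝 0) := by
      have := ENNReal.Tendsto.mul_const (b := volume V)
        (ENNReal.tendsto_ofReal (tendsto_one_div_add_atTop_nhds_zero_nat (𝕜 := ℝ))) (Or.inr hVf)
      simpa using this
    refine tendsto_of_tendsto_of_tendsto_of_le_of_le tendsto_const_nhds q0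
      (fun _ => zero_le) (fun m => ?_)
    refine (setLIntegral_mono' hV (fun p hp => ?_)).trans_eq (setLIntegral_const _ _)
    rw [← ofReal_norm]
    exact ENNReal.ofReal_le_ofReal (h5 m p hp)
  · have q0 := ENNReal.Tendsto.mul_const (b := volume.restrict V univ ^
        (1 / (1 : ℝ≥0∞).toReal - 1 / (2 : ℝ≥0∞).toReal)) hDt
      (Or.inr (ENNReal.rpow_ne_top_of_nonneg (by norm_num) (measure_ne_top _ _)))
    rw [zero_mul] at q0
    refine tendsto_of_tendsto_of_tendsto_of_le_of_le tendsto_const_nhds q0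
      (fun _ => zero_le) (fun m => ?_)
    have := eLpNorm_le_eLpNorm_mul_rpow_measure_univ (p := 1) (q := 2) one_le_two
      ((Lp.memLp (E m)).1.sub (Lp.memLp D).1)
    rw [eLpNorm_one_eq_lintegral_enorm] at this
    exact this

end Sobolev

/-! ### The fractional Sobolev inequality -/

/-- The Gagliardo energy `∬ |u(x) - u(y)|² / |x - y|^{n + 2s} dx dy` over `ℝⁿ × ℝⁿ`. -/
noncomputable def gagliardo {n : ℕ} (s : ℝ) (u : Rn n → ℝ) : ℝ≥0∞ :=
  ∫⁻ x, ∫⁻ y, ENNReal.ofReal (‖x - y‖ ^ (-((n : ℝ) + 2 * s))) * ‖u x - u y‖ₑ ^ 2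

/-- The measures of two consecutive dyadic level sets of a function of finite Gagliardo energy.
A ball of twice the measure of `{t ≤ |u|}` around a point of `{2t ≤ |u|}` contains a set of
measure `|{t ≤ |u|}|` on which the jump of `u` exceeds `t`. -/
theorem exists_measure_levelSet_le {n : ℕ} (hn : 0 < n) {s : ℝ} (hs : 0 < s) :
    ∃ D : ℝ, 0 < D ∧ ∀ u : Rn n → ℝ, Measurable u → ∀ E : ℝ, 0 ≤ E →
      gagliardo s u ≤ ENNReal.ofReal E → ∀ t : ℝ, 0 < t → volume {x | t ≤ |u x|} ≠ ⊤ →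
      volume.real {x | 2 * t ≤ |u x|} * t ^ 2 ≤
        D * E * volume.real {x | t ≤ |u x|} ^ (2 * s / n) := by
  have hn' : (0 : ℝ) < n := by exact_mod_cast hn
  set κ := volume.real (Metric.ball (0 : Rn n) 1) with hκ
  have hκ0 : 0 < κ := ENNReal.toReal_pos (Metric.measure_ball_pos _ _ one_pos).ne'
    measure_ball_lt_top.ne
  refine ⟨(2 / κ) ^ (1 + 2 * s / n), by positivity, fun u hu E hE0 hE t ht hfin => ?_⟩
  set L : ℝ → Set (Rn n) := fun t => {x | t ≤ |u x|} with hL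
  have hLm : ∀ t, MeasurableSet (L t) := fun t => measurableSet_le measurable_const hu.abs
  have hsub : L (2 * t) ⊆ L t := fun x (hx : 2 * t ≤ |u x|) => (by linarith : t ≤ |u x|)
  change volume.real (L (2 * t)) * t ^ 2 ≤ _ * E * volume.real (L t) ^ (2 * s / n)
  change volume (L t) ≠ ⊤ at hfin
  have hfin2 : volume (L (2 * t)) ≠ ⊤ := ne_top_of_le_ne_top hfin (measure_mono hsub)
  set a := volume.real (L t) with ha
  rcases (measureReal_nonneg : 0 ≤ a).eq_or_lt with ha0 | ha0
  · have : volume.real (L (2 * t)) ≤ a := measureReal_mono hsub hfin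
    have h0 : volume.real (L (2 * t)) = 0 := le_antisymm (this.trans ha0.symm.le) measureReal_nonneg
    rw [h0, zero_mul]
    positivity
  have haof : volume (L t) = ENNReal.ofReal a := (ofReal_measureReal hfin).symm
  -- the radius of a ball of measure `2 * a`
  set R : ℝ := (2 * a / κ) ^ (1 / (n : ℝ)) with hR
  have hR0 : 0 < R := by positivity
  have hRn : R ^ n = 2 * a / κ := by
    rw [← Real.rpow_natCast, hR, ← Real.rpow_mul (by positivity), one_div_mul_cancel hn'.ne',
      Real.rpow_one]
  have hball : ∀ x : Rn n, volume (Metric.ball x R) = ENNReal.ofReal (2 * a) := by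
    intro x
    rw [Measure.addHaar_ball_of_pos _ _ hR0, finrank_euclideanSpace_fin, hRn,
      ← ofReal_measureReal (measure_ball_lt_top (x := (0 : Rn n)) (r := 1)).ne, ← hκ,
      ← ENNReal.ofReal_mul (by positivity), div_mul_cancel₀ _ hκ0.ne']
  have hdiff : ∀ x : Rn n, ENNReal.ofReal a ≤ volume (Metric.ball x R \ L t) := by
    intro x
    refine le_trans ?_ (le_measure_sdiff (μ := volume) (s₁ := Metric.ball x R) (s₂ := L t))
    rw [hball, haof, ← ENNReal.ofReal_sub _ ha0.le]
    exact ENNReal.ofReal_le_ofReal (by linarith)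
  have hinner : ∀ x ∈ L (2 * t),
      ENNReal.ofReal (R ^ (-((n : ℝ) + 2 * s)) * t ^ 2 * a) ≤
        ∫⁻ y, ENNReal.ofReal (‖x - y‖ ^ (-((n : ℝ) + 2 * s))) * ‖u x - u y‖ₑ ^ 2 := by
    intro x hx
    calc ENNReal.ofReal (R ^ (-((n : ℝ) + 2 * s)) * t ^ 2 * a)
        = ENNReal.ofReal (R ^ (-((n : ℝ) + 2 * s)) * t ^ 2) * ENNReal.ofReal a :=
          ENNReal.ofReal_mul (by positivity)
      _ ≤ ENNReal.ofReal (R ^ (-((n : ℝ) + 2 * s)) * t ^ 2) *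
          volume (Metric.ball x R \ L t) := by gcongr; exact hdiff x
      _ = ∫⁻ _ in Metric.ball x R \ L t, ENNReal.ofReal (R ^ (-((n : ℝ) + 2 * s)) * t ^ 2) :=
          (setLIntegral_const _ _).symm
      _ ≤ ∫⁻ y in Metric.ball x R \ L t,
          ENNReal.ofReal (‖x - y‖ ^ (-((n : ℝ) + 2 * s))) * ‖u x - u y‖ₑ ^ 2 := by
        refine setLIntegral_mono' (measurableSet_ball.diff (hLm t)) fun y hy => ?_
        have hy2 : |u y| < t := not_le.1 hy.2
        have hx2 : 2 * t ≤ |u x| := hx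
        have hxy : t ≤ |u x - u y| := by linarith [abs_sub_abs_le_abs_sub (u x) (u y)]
        have hne : 0 < ‖x - y‖ := by
          refine norm_pos_iff.2 (sub_ne_zero.2 ?_)
          rintro rfl
          linarith
        have hlt : ‖x - y‖ ≤ R := by
          have := Metric.mem_ball.1 hy.1
          rw [dist_comm, dist_eq_norm] at this
          exact this.le
        rw [← ofReal_norm, ← ENNReal.ofReal_pow (norm_nonneg _), ← ENNReal.ofReal_mul
          (by positivity), Real.norm_eq_abs]
        refine ENNReal.ofReal_le_ofReal ?_
        refine mul_le_mul ?_ (by gcongr) (by positivity) (by positivity)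
        exact Real.rpow_le_rpow_of_nonpos hne hlt (by linarith)
      _ ≤ _ := setLIntegral_le_lintegral _ _
  have hmain : R ^ (-((n : ℝ) + 2 * s)) * t ^ 2 * a * volume.real (L (2 * t)) ≤ E := by
    rw [← ENNReal.ofReal_le_ofReal_iff hE0, ENNReal.ofReal_mul (by positivity),
      ofReal_measureReal hfin2, ← setLIntegral_const]
    refine le_trans ?_ hE
    exact (setLIntegral_mono' (hLm _) hinner).trans (setLIntegral_le_lintegral _ _)
  have hRexp : R ^ ((n : ℝ) + 2 * s) = a * ((2 / κ) ^ (1 + 2 * s / n) * a ^ (2 * s / n)) := by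
    rw [hR, ← Real.rpow_mul (by positivity)]
    have e1 : 1 / (n : ℝ) * (n + 2 * s) = 1 + 2 * s / n := by field_simp
    rw [e1, show 2 * a / κ = 2 / κ * a by ring, Real.mul_rpow (by positivity) ha0.le,
      Real.rpow_add ha0, Real.rpow_one]
    ring
  rw [Real.rpow_neg hR0.le] at hmain
  have hRp : 0 < R ^ ((n : ℝ) + 2 * s) := by positivity
  have h2 : a * (volume.real (L (2 * t)) * t ^ 2) ≤ R ^ ((n : ℝ) + 2 * s) * E := by
    calc _ = R ^ ((n : ℝ) + 2 * s) *
        ((R ^ ((n : ℝ) + 2 * s))⁻¹ * t ^ 2 * a * volume.real (L (2 * t))) := by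
          field_simp
      _ ≤ _ := by gcongr
  rw [hRexp] at h2
  have h3 : a * (volume.real (L (2 * t)) * t ^ 2) ≤
      a * ((2 / κ) ^ (1 + 2 * s / n) * E * a ^ (2 * s / n)) := by
    refine h2.trans_eq (by ring)
  exact le_of_mul_le_mul_left h3 ha0

/-- A recursive inequality `a (k + 1) ≤ D 4⁻ᵏ (a k) ^ β` with `β < 1` forces geometric decay with
ratio `2 ^ (-p)`, where `p = 2 / (1 - β)` is the fixed point of `p = 2 + β p`. -/
theorem exists_geometric_bound {β D W : ℝ} (hβ0 : 0 ≤ β) (hβ1 : β < 1) (hD : 0 ≤ D) :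
    ∃ B : ℝ, 0 < B ∧ ∀ a : ℕ → ℝ, (∀ k, 0 ≤ a k) → a 0 ≤ W →
      (∀ k, a (k + 1) * ((2 : ℝ) ^ k) ^ 2 ≤ D * a k ^ β) →
      ∀ k, a k ≤ B * ((2 : ℝ) ^ (-(2 / (1 - β)))) ^ k := by
  have hβ : 0 < 1 - β := by linarith
  set θ : ℝ := (2 : ℝ) ^ (-(2 / (1 - β))) with hθ
  have hθ0 : 0 < θ := by positivity
  have hθβ : θ ^ β = 4 * θ := by
    rw [hθ, ← Real.rpow_mul two_pos.le, show (4 : ℝ) = 2 ^ (2 : ℝ) by norm_num,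
      ← Real.rpow_add two_pos]
    congr 1
    field_simp
    ring
  -- the last entry of the maximum makes the induction step close, `D * B ^ β ≤ B * θ`
  set B : ℝ := max (max W 1) ((D / θ) ^ (1 / (1 - β))) with hB
  have hB0 : 0 < B := lt_of_lt_of_le one_pos ((le_max_right _ _).trans (le_max_left _ _))
  have hBD : D * B ^ β ≤ B * θ := by
    have h1 : D / θ ≤ B ^ (1 - β) := by
      have : D / θ = ((D / θ) ^ (1 / (1 - β))) ^ (1 - β) := by
        rw [← Real.rpow_mul (by positivity), one_div_mul_cancel hβ.ne', Real.rpow_one]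
      rw [this]
      exact Real.rpow_le_rpow (by positivity) (le_max_right _ _) hβ.le
    rw [div_le_iff₀ hθ0] at h1
    calc D * B ^ β ≤ B ^ (1 - β) * θ * B ^ β := by gcongr
      _ = B ^ (1 - β + β) * θ := by rw [Real.rpow_add hB0]; ring
      _ = B * θ := by rw [sub_add_cancel, Real.rpow_one]
  refine ⟨B, hB0, fun a ha h0 hrec k => ?_⟩
  induction k with
  | zero =>
    rw [pow_zero, mul_one]
    exact h0.trans ((le_max_left _ _).trans (le_max_left _ _))
  | succ k ih =>
    have e4 : ((2 : ℝ) ^ k) ^ 2 = 4 ^ k := by rw [← pow_mul, mul_comm, pow_mul]; norm_num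
    have h1 := hrec k
    rw [e4] at h1
    have h2 : a k ^ β ≤ B ^ β * (4 ^ k * θ ^ k) := by
      calc a k ^ β ≤ (B * θ ^ k) ^ β := Real.rpow_le_rpow (ha k) ih hβ0
        _ = B ^ β * (θ ^ β) ^ k := by
          rw [Real.mul_rpow hB0.le (by positivity), ← Real.rpow_natCast, ← Real.rpow_mul hθ0.le,
            mul_comm (k : ℝ), Real.rpow_mul hθ0.le, Real.rpow_natCast]
        _ = _ := by rw [hθβ, mul_pow]
    have h3 : a (k + 1) * 4 ^ k ≤ B * θ ^ (k + 1) * 4 ^ k := by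
      calc a (k + 1) * 4 ^ k ≤ D * (B ^ β * (4 ^ k * θ ^ k)) :=
            h1.trans (mul_le_mul_of_nonneg_left h2 hD)
        _ = D * B ^ β * (4 ^ k * θ ^ k) := by ring
        _ ≤ B * θ * (4 ^ k * θ ^ k) := by gcongr
        _ = _ := by ring
    exact le_of_mul_le_mul_right h3 (by positivity)

/-- The subcritical fractional Sobolev inequality, in the form of a uniform bound on bounded
sets of functions of finite Gagliardo energy. The measures of the level sets `{2ᵏ ≤ |u|}` decay
like `2 ^ (-k p)` with the critical exponent `p = 2n / (n - 2s)`, which makes the sum of the `q`-th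
powers over dyadic levels converge. -/
theorem exists_lintegral_rpow_le {n : ℕ} (hn : 0 < n) {s : ℝ} (hs : 0 < s) (hsn : 2 * s < n)
    {q : ℝ} (hq0 : 0 < q) (hq : q < 2 * n / (n - 2 * s)) {W E : ℝ} (hE0 : 0 ≤ E) :
    ∃ S : ℝ≥0∞, S ≠ ⊤ ∧ ∀ u : Rn n → ℝ, Measurable u →
      volume {x | 1 ≤ |u x|} ≤ ENNReal.ofReal W → gagliardo s u ≤ ENNReal.ofReal E →
      ∀ Ω : Set (Rn n), ∫⁻ x in Ω, ‖u x‖ₑ ^ q ≤ volume Ω + S := by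
  have hn' : (0 : ℝ) < n := by exact_mod_cast hn
  obtain ⟨D, hD0, hD⟩ := exists_measure_levelSet_le hn hs
  obtain ⟨B, hB0, hB⟩ := exists_geometric_bound (β := 2 * s / n) (D := D * E) (W := max W 0)
    (by positivity) ((div_lt_one hn').2 hsn) (by positivity)
  set θ : ℝ := (2 : ℝ) ^ (-(2 / (1 - 2 * s / n))) with hθ
  have hθ0 : 0 < θ := by positivity
  have hratio : (2 : ℝ) ^ q * θ < 1 := by
    rw [hθ, ← Real.rpow_add two_pos]
    refine Real.rpow_lt_one_of_one_lt_of_neg one_lt_two ?_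
    have : 2 / (1 - 2 * s / n) = 2 * n / (n - 2 * s) := by
      have : (n : ℝ) - 2 * s ≠ 0 := by linarith
      field_simp
    rw [this]
    linarith
  have hsum : Summable fun k : ℕ => (2 : ℝ) ^ q * B * ((2 : ℝ) ^ q * θ) ^ k :=
    (summable_geometric_of_lt_one (by positivity) hratio).mul_left _
  refine ⟨∑' k : ℕ, ENNReal.ofReal ((2 : ℝ) ^ q * B * ((2 : ℝ) ^ q * θ) ^ k), ?_, ?_⟩
  · rw [← ENNReal.ofReal_tsum_of_nonneg (fun k => by positivity) hsum]
    exact ENNReal.ofReal_ne_top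
  intro u hu hW hE Ω
  set L : ℕ → Set (Rn n) := fun k => {x | (2 : ℝ) ^ k ≤ |u x|} with hL
  have hLm : ∀ k, MeasurableSet (L k) := fun k => measurableSet_le measurable_const hu.abs
  have hL0 : ∀ k, volume (L k) ≤ ENNReal.ofReal W := fun k =>
    (measure_mono fun x (hx : (2 : ℝ) ^ k ≤ |u x|) =>
      (one_le_pow₀ one_le_two).trans hx).trans hW
  have hLfin : ∀ k, volume (L k) ≠ ⊤ := fun k => ne_top_of_le_ne_top ENNReal.ofReal_ne_top (hL0 k)
  have hLB : ∀ k, volume.real (L k) ≤ B * θ ^ k := by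
    refine hB _ (fun k => measureReal_nonneg) ?_ fun k => ?_
    · refine ENNReal.toReal_le_of_le_ofReal (le_max_right _ _) ((hL0 0).trans ?_)
      exact ENNReal.ofReal_le_ofReal (le_max_left _ _)
    · have := hD u hu E hE0 hE (2 ^ k) (by positivity) (hLfin k)
      rw [← pow_succ'] at this
      exact this
  -- dyadic decomposition of the values of `|u|` above `1`
  have hpt : ∀ x, ‖u x‖ₑ ^ q ≤ 1 + ∑' k : ℕ, (L k).indicator
      (fun _ => ENNReal.ofReal ((2 : ℝ) ^ q * ((2 : ℝ) ^ q) ^ k)) x := by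
    intro x
    rw [← ofReal_norm, Real.norm_eq_abs]
    rcases lt_or_ge |u x| 1 with h1 | h1
    · refine le_trans ?_ le_self_add
      refine ENNReal.rpow_le_one ?_ hq0.le
      rw [← ENNReal.ofReal_one]
      exact ENNReal.ofReal_le_ofReal h1.le
    · obtain ⟨k, hk1, hk2⟩ := exists_nat_pow_near h1 one_lt_two
      refine le_trans ?_ le_add_self
      refine le_trans ?_ (ENNReal.le_tsum k)
      rw [indicator_of_mem (show x ∈ L k from hk1), ENNReal.ofReal_rpow_of_nonneg (abs_nonneg _)
        hq0.le]
      refine ENNReal.ofReal_le_ofReal ((Real.rpow_le_rpow (abs_nonneg _) hk2.le hq0.le).trans_eq ?_)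
      rw [← pow_succ', ← Real.rpow_natCast, ← Real.rpow_natCast, ← Real.rpow_mul two_pos.le,
        ← Real.rpow_mul two_pos.le, mul_comm]
  calc ∫⁻ x in Ω, ‖u x‖ₑ ^ q
      ≤ ∫⁻ x in Ω, (1 + ∑' k : ℕ, (L k).indicator
        (fun _ => ENNReal.ofReal ((2 : ℝ) ^ q * ((2 : ℝ) ^ q) ^ k)) x) := lintegral_mono hpt
    _ = volume Ω + ∑' k : ℕ, ∫⁻ x in Ω, (L k).indicator
        (fun _ => ENNReal.ofReal ((2 : ℝ) ^ q * ((2 : ℝ) ^ q) ^ k)) x := by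
      rw [lintegral_add_left measurable_const, lintegral_tsum
        fun k => (measurable_const.indicator (hLm k)).aemeasurable]
      simp
    _ ≤ _ := by
      gcongr with k
      rw [lintegral_indicator_const (hLm k)]
      calc _ ≤ ENNReal.ofReal ((2 : ℝ) ^ q * ((2 : ℝ) ^ q) ^ k) * volume (L k) := by
            exact mul_le_mul_right (Measure.restrict_apply_le _ _) _
        _ = ENNReal.ofReal ((2 : ℝ) ^ q * ((2 : ℝ) ^ q) ^ k * volume.real (L k)) := by
          rw [ENNReal.ofReal_mul (p := (2 : ℝ) ^ q * ((2 : ℝ) ^ q) ^ k) (by positivity),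
            ofReal_measureReal (hLfin k)]
        _ ≤ _ := by
          refine ENNReal.ofReal_le_ofReal ?_
          calc _ ≤ (2 : ℝ) ^ q * ((2 : ℝ) ^ q) ^ k * (B * θ ^ k) := by
                gcongr
                exact hLB k
            _ = _ := by rw [mul_pow]; ring

/-! ### The energy as a Hilbert space norm -/

theorem inner_toLp_toLp {α : Type*} [MeasurableSpace α] {μ : Measure α} {f g : α → ℝ}
    (hf : MemLp f 2 μ) (hg : MemLp g 2 μ) :
    inner ℝ (hf.toLp f) (hg.toLp g) = ∫ x, f x * g x ∂μ := by
  rw [L2.inner_def]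
  refine integral_congr_ae ?_
  filter_upwards [hf.coeFn_toLp, hg.coeFn_toLp] with x h1 h2
  rw [h1, h2, RCLike.inner_apply, conj_trivial, mul_comm]

theorem norm_toLp_sq {α : Type*} [MeasurableSpace α] {μ : Measure α} {f : α → ℝ}
    (hf : MemLp f 2 μ) : ‖hf.toLp f‖ ^ 2 = ∫ x, f x ^ 2 ∂μ := by
  rw [← real_inner_self_eq_norm_sq, inner_toLp_toLp]
  simp only [sq]

section Energy

variable {n : ℕ} {s : ℝ} {K : Rn n → ℝ} {Ω : Set (Rn n)}

/-- The jump `K(x - y)^{1/2} (u(x) - u(y))`, whose `L²` norm on `ℝⁿ × ℝⁿ` is the energy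
seminorm. It vanishes on the diagonal, so the value `K 0` is irrelevant. -/
noncomputable def jump (K : Rn n → ℝ) (u : Rn n → ℝ) (p : Rn n × Rn n) : ℝ :=
  Real.sqrt (K (p.1 - p.2)) * (u p.1 - u p.2)

theorem IsKernel.jump_mul_jump (hK : IsKernel s K) (u v : Rn n → ℝ) (p : Rn n × Rn n) :
    jump K u p * jump K v p = K (p.1 - p.2) * (u p.1 - u p.2) * (v p.1 - v p.2) := by
  by_cases hp : p.1 = p.2
  · simp [jump, hp]
  · have := Real.mul_self_sqrt (hK.nonneg _ (sub_ne_zero.2 hp))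
    simp only [jump]
    linear_combination (u p.1 - u p.2) * (v p.1 - v p.2) * this

theorem IsKernel.jump_sq (hK : IsKernel s K) (u : Rn n → ℝ) (p : Rn n × Rn n) :
    jump K u p ^ 2 = K (p.1 - p.2) * (u p.1 - u p.2) ^ 2 := by
  rw [sq, hK.jump_mul_jump]
  ring

theorem IsKernel.aestronglyMeasurable_jump (hK : IsKernel s K) {u : Rn n → ℝ}
    (hu : AEStronglyMeasurable u volume) : AEStronglyMeasurable (jump K u) volume := by
  obtain ⟨K', hm, hK'⟩ := hK.aestronglyMeasurable
  have h : jump K u = fun p : Rn n × Rn n => Real.sqrt (K' (p.1 - p.2)) * (u p.1 - u p.2) := by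
    funext p
    by_cases hp : p.1 = p.2
    · simp [jump, hp]
    · rw [jump, hK' _ (sub_ne_zero.2 hp)]
  rw [h]
  have h1 : AEStronglyMeasurable (fun p : Rn n × Rn n => Real.sqrt (K' (p.1 - p.2))) volume :=
    Real.continuous_sqrt.comp_aestronglyMeasurable
      (hm.comp_quasiMeasurePreserving (quasiMeasurePreserving_sub volume volume))
  have h2 : AEStronglyMeasurable (fun p : Rn n × Rn n => u p.1) volume :=
    hu.comp_quasiMeasurePreserving Measure.quasiMeasurePreserving_fst
  have h3 : AEStronglyMeasurable (fun p : Rn n × Rn n => u p.2) volume :=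
    hu.comp_quasiMeasurePreserving Measure.quasiMeasurePreserving_snd
  exact h1.mul (h2.sub h3)

theorem energy_eq_zero_of_notMem_Q {u : Rn n → ℝ} (hu : ∀ x, x ∉ Ω → u x = 0)
    {p : Rn n × Rn n} (hp : p ∉ Q Ω) : K (p.1 - p.2) * (u p.1 - u p.2) ^ 2 = 0 := by
  have hp' : p ∈ Ωᶜ ×ˢ Ωᶜ := not_not.1 hp
  rw [hu _ hp'.1, hu _ hp'.2]
  ring

theorem memLp_jump (hK : IsKernel s K) (u : XTilde hK Ω) :
    MemLp (jump K (u : Rn n → ℝ)) 2 volume := by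
  rw [memLp_two_iff_integrable_sq (hK.aestronglyMeasurable_jump u.2.1.1)]
  simp only [hK.jump_sq]
  refine (integrableOn_iff_integrable_of_support_subset (s := Q Ω) ?_).1 u.2.1.3
  intro p hp
  by_contra h
  exact hp (energy_eq_zero_of_notMem_Q u.2.2 h)

/-- The restriction of a function in `X̃` to `Ω`, as an element of `L²(Ω)`. -/
noncomputable def restrictL2 (hK : IsKernel s K) (Ω : Set (Rn n)) :
    XTilde hK Ω →ₗ[ℝ] Lp ℝ 2 (volume.restrict Ω) where
  toFun u := u.2.1.memLp.toLp (u : Rn n → ℝ)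
  map_add' u v := MemLp.toLp_add u.2.1.memLp v.2.1.memLp
  map_smul' c u := MemLp.toLp_const_smul c u.2.1.memLp

/-- The jump of a function in `X̃`, as an element of `L²(ℝⁿ × ℝⁿ)`. -/
noncomputable def jumpL2 (hK : IsKernel s K) (Ω : Set (Rn n)) :
    XTilde hK Ω →ₗ[ℝ] Lp ℝ 2 (volume : Measure (Rn n × Rn n)) where
  toFun u := (memLp_jump hK u).toLp (jump K (u : Rn n → ℝ))
  map_add' u v := by
    rw [← MemLp.toLp_add]
    refine MemLp.toLp_congr _ _ (Eventually.of_forall fun p => ?_)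
    simp only [jump, Submodule.coe_add, Pi.add_apply]
    ring
  map_smul' c u := by
    rw [RingHom.id_apply, ← MemLp.toLp_const_smul]
    refine MemLp.toLp_congr _ _ (Eventually.of_forall fun p => ?_)
    simp only [jump, Submodule.coe_smul, Pi.smul_apply, smul_eq_mul]
    ring

theorem norm_restrictL2_le (hK : IsKernel s K) (u : XTilde hK Ω) :
    ‖restrictL2 hK Ω u‖ ≤ normX K Ω (u : Rn n → ℝ) := by
  rw [← Real.sqrt_sq (norm_nonneg (restrictL2 hK Ω u))]
  have : ‖restrictL2 hK Ω u‖ ^ 2 = _ := norm_toLp_sq u.2.1.memLp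
  rw [this]
  exact le_add_of_nonneg_right (Real.sqrt_nonneg _)

theorem norm_jumpL2_sq (hK : IsKernel s K) (u : XTilde hK Ω) :
    ‖jumpL2 hK Ω u‖ ^ 2 =
      ∫ p : Rn n × Rn n, K (p.1 - p.2) * ((u : Rn n → ℝ) p.1 - (u : Rn n → ℝ) p.2) ^ 2 := by
  simp only [← hK.jump_sq]
  exact norm_toLp_sq (memLp_jump hK u)

theorem norm_jumpL2_le (hK : IsKernel s K) (u : XTilde hK Ω) :
    ‖jumpL2 hK Ω u‖ ≤ normX K Ω (u : Rn n → ℝ) := by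
  rw [← Real.sqrt_sq (norm_nonneg (jumpL2 hK Ω u)), norm_jumpL2_sq,
    ← setIntegral_eq_integral_of_forall_compl_eq_zero (s := Q Ω)
      fun p hp => energy_eq_zero_of_notMem_Q u.2.2 hp]
  exact le_add_of_nonneg_left (Real.sqrt_nonneg _)

theorem inner_jumpL2 (hK : IsKernel s K) (u v : XTilde hK Ω) :
    inner ℝ (jumpL2 hK Ω v) (jumpL2 hK Ω u) =
      ∫ p : Rn n × Rn n, K (p.1 - p.2) * ((u : Rn n → ℝ) p.1 - (u : Rn n → ℝ) p.2) *
          ((v : Rn n → ℝ) p.1 - (v : Rn n → ℝ) p.2) := by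
  simp only [← hK.jump_mul_jump]
  rw [real_inner_comm]
  exact inner_toLp_toLp (memLp_jump hK u) (memLp_jump hK v)

theorem integrable_energy (hK : IsKernel s K) (u v : XTilde hK Ω) :
    Integrable (fun p : Rn n × Rn n => K (p.1 - p.2) *
      ((u : Rn n → ℝ) p.1 - (u : Rn n → ℝ) p.2) * ((v : Rn n → ℝ) p.1 - (v : Rn n → ℝ) p.2)) := by
  simp only [← hK.jump_mul_jump]
  exact (memLp_jump hK u).integrable_mul (memLp_jump hK v)

section WeakConvergence

variable {hK : IsKernel s K} {uk : ℕ → XTilde hK Ω} {u : XTilde hK Ω}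
  {H : Type*} [NormedAddCommGroup H] [InnerProductSpace ℝ H]

theorem WeaklyConverges.tendsto_inner (h : WeaklyConverges hK Ω uk u) (T : XTilde hK Ω →ₗ[ℝ] H)
    (hT : ∀ w, ‖T w‖ ≤ normX K Ω (w : Rn n → ℝ)) (y : H) :
    Tendsto (fun k => inner ℝ y (T (uk k))) atTop (𝓝 (inner ℝ y (T u))) := by
  refine h ((innerSL ℝ y).toLinearMap ∘ₗ T) ⟨‖y‖, fun w => ?_⟩
  exact (abs_real_inner_le_norm _ _).trans (mul_le_mul_of_nonneg_left (hT w) (norm_nonneg _))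

/-- Weakly convergent sequences are bounded, by the uniform boundedness principle in the Hilbert
space `H`. -/
theorem WeaklyConverges.exists_norm_le [CompleteSpace H] (h : WeaklyConverges hK Ω uk u)
    (T : XTilde hK Ω →ₗ[ℝ] H) (hT : ∀ w, ‖T w‖ ≤ normX K Ω (w : Rn n → ℝ)) :
    ∃ B : ℝ, ∀ k, ‖T (uk k)‖ ≤ B := by
  obtain ⟨B, hB⟩ := banach_steinhaus (g := fun k => innerSL ℝ (T (uk k))) fun y => by
    obtain ⟨c, hc⟩ := (h.tendsto_inner T hT y).norm.bddAbove_range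
    refine ⟨c, fun k => ?_⟩
    rw [innerSL_apply_apply, real_inner_comm]
    exact hc (mem_range_self k)
  exact ⟨B, fun k => by simpa using hB k⟩

end WeakConvergence

theorem gagliardo_congr {u v : Rn n → ℝ} (h : u =ᵐ[volume] v) : gagliardo s u = gagliardo s v := by
  refine lintegral_congr_ae ?_
  filter_upwards [h] with x hx
  refine lintegral_congr_ae ?_
  filter_upwards [h] with y hy
  rw [hx, hy]

/-- The lower bound on the kernel makes the Gagliardo energy subordinate to the energy of `X̃`. -/
theorem exists_gagliardo_le (hK : IsKernel s K) (Ω : Set (Rn n)) :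
    ∃ c : ℝ, 0 < c ∧ ∀ u : XTilde hK Ω, ∀ B : ℝ, ‖jumpL2 hK Ω u‖ ≤ B →
      gagliardo s (u : Rn n → ℝ) ≤ ENNReal.ofReal (B ^ 2 / c) := by
  obtain ⟨c, hc, hcK⟩ := hK.lower
  refine ⟨c, hc, fun u B hB => ?_⟩
  have h1 : ENNReal.ofReal c * gagliardo s (u : Rn n → ℝ) ≤ ENNReal.ofReal (B ^ 2) := by
    calc ENNReal.ofReal c * gagliardo s (u : Rn n → ℝ)
        = ∫⁻ x, ∫⁻ y, ENNReal.ofReal c * (ENNReal.ofReal (‖x - y‖ ^ (-((n : ℝ) + 2 * s))) *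
            ‖(u : Rn n → ℝ) x - (u : Rn n → ℝ) y‖ₑ ^ 2) := by
          rw [gagliardo, ← lintegral_const_mul' _ _ ENNReal.ofReal_ne_top]
          simp only [← lintegral_const_mul' _ _ ENNReal.ofReal_ne_top]
      _ ≤ ∫⁻ x, ∫⁻ y, ENNReal.ofReal (jump K (u : Rn n → ℝ) (x, y) ^ 2) := by
          refine lintegral_mono fun x => lintegral_mono fun y => ?_
          rw [hK.jump_sq]
          by_cases hxy : x = y
          · simp [hxy]
          · rw [← ofReal_norm, ← ENNReal.ofReal_pow (norm_nonneg _), ← ENNReal.ofReal_mul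
              (by positivity), ← ENNReal.ofReal_mul hc.le, Real.norm_eq_abs, sq_abs, ← mul_assoc]
            refine ENNReal.ofReal_le_ofReal ?_
            exact mul_le_mul_of_nonneg_right (hcK _ (sub_ne_zero.2 hxy)) (sq_nonneg _)
      _ = ∫⁻ p, ENNReal.ofReal (jump K (u : Rn n → ℝ) p ^ 2) :=
          (lintegral_prod _ ((hK.aestronglyMeasurable_jump
            u.2.1.1).aemeasurable.pow_const 2).ennreal_ofReal).symm
      _ = ENNReal.ofReal (‖jumpL2 hK Ω u‖ ^ 2) := by
          rw [← ofReal_integral_eq_lintegral_ofReal ((memLp_jump hK u).integrable_sq)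
            (Eventually.of_forall fun p => sq_nonneg _)]
          congr 1
          exact (norm_toLp_sq (memLp_jump hK u)).symm
      _ ≤ _ := ENNReal.ofReal_le_ofReal (pow_le_pow_left₀ (norm_nonneg _) hB 2)
  rw [ENNReal.ofReal_div_of_pos hc, ENNReal.le_div_iff_mul_le
    (Or.inl (ENNReal.ofReal_pos.2 hc).ne') (Or.inl ENNReal.ofReal_ne_top), mul_comm]
  exact h1

/-- The embedding of `X̃` into `L^q(Ω)` maps sets of bounded energy to bounded sets. -/
theorem exists_eLpNorm_le (hn : 0 < n) (hs : 0 < s) (hsn : 2 * s < n) (hK : IsKernel s K)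
    (hΩ : volume Ω ≠ ⊤) {q : ℝ} (hq0 : 0 < q) (hq : q < 2 * n / (n - 2 * s)) (B : ℝ) :
    ∃ S : ℝ≥0∞, S ≠ ⊤ ∧ ∀ u : XTilde hK Ω, ‖jumpL2 hK Ω u‖ ≤ B →
      eLpNorm (u : Rn n → ℝ) (ENNReal.ofReal q) (volume.restrict Ω) ≤ S := by
  obtain ⟨c, hc, hcB⟩ := exists_gagliardo_le hK Ω
  obtain ⟨S, hS, h⟩ := exists_lintegral_rpow_le hn hs hsn hq0 hq (W := volume.real Ω)
    (E := B ^ 2 / c) (by positivity)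
  refine ⟨(volume Ω + S) ^ (1 / q), ENNReal.rpow_ne_top_of_nonneg (by positivity)
    (ENNReal.add_ne_top.2 ⟨hΩ, hS⟩), fun u hu => ?_⟩
  have hae := u.2.1.1.ae_eq_mk
  rw [eLpNorm_congr_ae (ae_restrict_of_ae hae), eLpNorm_eq_lintegral_rpow_enorm_toReal
    (ENNReal.ofReal_pos.2 hq0).ne' ENNReal.ofReal_ne_top, ENNReal.toReal_ofReal hq0.le]
  refine ENNReal.rpow_le_rpow (h _ u.2.1.1.measurable_mk ?_ ?_ Ω) (by positivity)
  · rw [ofReal_measureReal hΩ]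
    refine measure_mono_ae ?_
    filter_upwards [hae] with x hx (h1 : 1 ≤ |u.2.1.1.mk (u : Rn n → ℝ) x|)
    by_contra hxΩ
    rw [← hx, u.2.2 x hxΩ, abs_zero] at h1
    linarith
  · rw [← gagliardo_congr hae]
    exact hcB u B hu

end Energy

/-! ### The compact embedding into `L¹(Ω)` -/

theorem aestronglyMeasurable_ballIntegral {n : ℕ} {w : Rn n → ℝ}
    (hw : AEStronglyMeasurable w volume) (ε : ℝ) :
    AEStronglyMeasurable (fun x => ∫ y in Metric.ball x ε, w y) volume := by
  have h1 : AEStronglyMeasurable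
      ({p : Rn n × Rn n | dist p.2 p.1 < ε}.indicator fun p => w p.2) (volume.prod volume) :=
    (hw.comp_quasiMeasurePreserving Measure.quasiMeasurePreserving_snd).indicator
      (measurableSet_lt (by fun_prop) measurable_const)
  refine h1.integral_prod_right'.congr (Eventually.of_forall fun x => ?_)
  exact integral_indicator (f := w) (s := Metric.ball x ε) measurableSet_ball

/-- A local average controls a function up to its Gagliardo energy: `|w(x)|` times the measure of
the ball is at most `∫ |w(x) - w(y)| dy + |∫ w(y) dy|` over the ball, and the jumps are absorbed by
the energy. After division by the measure of the ball, which is of order `εⁿ`, the energy terms are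
of order `ε ^ s`. -/
theorem lintegral_enorm_le {n : ℕ} {s : ℝ} {w : Rn n → ℝ} (hs : 0 < s)
    (hw : Integrable w) (Ω : Set (Rn n)) {ε : ℝ} (hε : 0 < ε) :
    volume (Metric.ball (0 : Rn n) ε) * ∫⁻ x in Ω, ‖w x‖ₑ ≤
      (ENNReal.ofReal (ε ^ s) * volume (Metric.ball (0 : Rn n) ε) * volume Ω +
        ENNReal.ofReal (ε ^ ((n : ℝ) + s)) * gagliardo s w) +
      ∫⁻ x in Ω, ‖∫ y in Metric.ball x ε, w y‖ₑ := by
  set m := volume (Metric.ball (0 : Rn n) ε) with hm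
  have hm' : ∀ x : Rn n, volume (Metric.ball x ε) = m := fun x => Measure.addHaar_ball_center _ x ε
  have hmtop : m ≠ ⊤ := measure_ball_lt_top.ne
  have hpt : ∀ x y : Rn n, dist y x < ε → ‖w x - w y‖ₑ ≤ ENNReal.ofReal (ε ^ s) +
      ENNReal.ofReal (ε ^ ((n : ℝ) + s)) *
        (ENNReal.ofReal (‖x - y‖ ^ (-((n : ℝ) + 2 * s))) * ‖w x - w y‖ₑ ^ 2) := by
    intro x y hxy
    by_cases hne : x = y
    · simp [hne]
    have h0 : 0 < ‖x - y‖ := norm_pos_iff.2 (sub_ne_zero.2 hne)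
    have hlt : ‖x - y‖ ≤ ε := by
      rw [dist_comm, dist_eq_norm] at hxy
      exact hxy.le
    rw [← ofReal_norm, ← ENNReal.ofReal_pow (norm_nonneg _), ← ENNReal.ofReal_mul (by positivity),
      ← ENNReal.ofReal_mul (by positivity), ← ENNReal.ofReal_add (by positivity) (by positivity)]
    refine ENNReal.ofReal_le_ofReal ?_
    set d := ‖w x - w y‖
    have h1 : ε ^ (-((n : ℝ) + 2 * s)) ≤ ‖x - y‖ ^ (-((n : ℝ) + 2 * s)) :=
      Real.rpow_le_rpow_of_nonpos h0 hlt (by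
        have : (0 : ℝ) ≤ n := n.cast_nonneg
        linarith)
    have h2 : ε ^ ((n : ℝ) + s) * ε ^ (-((n : ℝ) + 2 * s)) = (ε ^ s)⁻¹ := by
      rw [← Real.rpow_add hε, ← Real.rpow_neg hε.le]
      congr 1
      ring
    have he : 0 < ε ^ s := by positivity
    -- Young's inequality, weighted so that both terms are of order `ε ^ (n + s)` after integration
    have h3 : d ≤ ε ^ s + (ε ^ s)⁻¹ * d ^ 2 := by
      have : ε ^ s + (ε ^ s)⁻¹ * d ^ 2 - d = (ε ^ s)⁻¹ * ((ε ^ s - d) ^ 2 + ε ^ s * d) := by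
        field_simp
        ring
      have h4 : 0 ≤ (ε ^ s)⁻¹ * ((ε ^ s - d) ^ 2 + ε ^ s * d) := by positivity
      linarith
    calc d ≤ ε ^ s + (ε ^ s)⁻¹ * d ^ 2 := h3
      _ = ε ^ s + ε ^ ((n : ℝ) + s) * (ε ^ (-((n : ℝ) + 2 * s)) * d ^ 2) := by
        rw [← mul_assoc, h2]
      _ ≤ _ := by gcongr
  have hx : ∀ x : Rn n, m * ‖w x‖ₑ ≤ (ENNReal.ofReal (ε ^ s) * m +
      ENNReal.ofReal (ε ^ ((n : ℝ) + s)) * ∫⁻ y,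
        ENNReal.ofReal (‖x - y‖ ^ (-((n : ℝ) + 2 * s))) * ‖w x - w y‖ₑ ^ 2) +
      ‖∫ y in Metric.ball x ε, w y‖ₑ := by
    intro x
    have hint : IntegrableOn (fun _ : Rn n => w x) (Metric.ball x ε) :=
      integrableOn_const measure_ball_lt_top.ne
    have e1 : (∫ y in Metric.ball x ε, (w x - w y)) + ∫ y in Metric.ball x ε, w y =
        volume.real (Metric.ball x ε) * w x := by
      rw [integral_sub hint hw.integrableOn, sub_add_cancel, setIntegral_const, smul_eq_mul]
    have e2 : m * ‖w x‖ₑ = ‖volume.real (Metric.ball x ε) * w x‖ₑ := by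
      rw [enorm_mul, Real.enorm_of_nonneg measureReal_nonneg, ofReal_measureReal
        measure_ball_lt_top.ne, hm']
    rw [e2, ← e1]
    refine (enorm_add_le _ _).trans (add_le_add_left ?_ _)
    calc ‖∫ y in Metric.ball x ε, (w x - w y)‖ₑ
        ≤ ∫⁻ y in Metric.ball x ε, ‖w x - w y‖ₑ := enorm_integral_le_lintegral_enorm _
      _ ≤ ∫⁻ y in Metric.ball x ε, (ENNReal.ofReal (ε ^ s) + ENNReal.ofReal (ε ^ ((n : ℝ) + s)) *
          (ENNReal.ofReal (‖x - y‖ ^ (-((n : ℝ) + 2 * s))) * ‖w x - w y‖ₑ ^ 2)) :=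
        setLIntegral_mono' measurableSet_ball fun y hy => hpt x y hy
      _ = ENNReal.ofReal (ε ^ s) * m + ENNReal.ofReal (ε ^ ((n : ℝ) + s)) *
          ∫⁻ y in Metric.ball x ε,
            (ENNReal.ofReal (‖x - y‖ ^ (-((n : ℝ) + 2 * s))) * ‖w x - w y‖ₑ ^ 2) := by
        rw [lintegral_add_left measurable_const, setLIntegral_const, hm',
          lintegral_const_mul' _ _ ENNReal.ofReal_ne_top]
      _ ≤ _ := by
        gcongr
        exact Measure.restrict_le_self
  have hmeas : AEMeasurable (fun x => ‖∫ y in Metric.ball x ε, w y‖ₑ) (volume.restrict Ω) :=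
    (aestronglyMeasurable_ballIntegral hw.1 ε).enorm.mono_measure Measure.restrict_le_self
  calc m * ∫⁻ x in Ω, ‖w x‖ₑ = ∫⁻ x in Ω, m * ‖w x‖ₑ := (lintegral_const_mul' _ _ hmtop).symm
    _ ≤ _ := lintegral_mono hx
    _ = (ENNReal.ofReal (ε ^ s) * m * volume Ω + ENNReal.ofReal (ε ^ ((n : ℝ) + s)) *
        ∫⁻ x in Ω, ∫⁻ y, ENNReal.ofReal (‖x - y‖ ^ (-((n : ℝ) + 2 * s))) * ‖w x - w y‖ₑ ^ 2) +
      ∫⁻ x in Ω, ‖∫ y in Metric.ball x ε, w y‖ₑ := by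
      rw [lintegral_add_right' _ hmeas, lintegral_add_left measurable_const, setLIntegral_const,
        lintegral_const_mul' _ _ ENNReal.ofReal_ne_top]
    _ ≤ _ := by
      gcongr
      exact setLIntegral_le_lintegral _ _

/-- Compactness criterion: a sequence of bounded Gagliardo energy whose averages over balls tend to
zero converges to zero in `L¹(Ω)`. -/
theorem tendsto_lintegral_enorm_zero {n : ℕ} {s : ℝ} (hs : 0 < s) {w : ℕ → Rn n → ℝ}
    (hw : ∀ k, Integrable (w k)) {A : ℝ} (hA : ∀ k, ∫ x, ‖w k x‖ ≤ A) {E : ℝ≥0∞} (hE : E ≠ ⊤)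
    (hwE : ∀ k, gagliardo s (w k) ≤ E) {Ω : Set (Rn n)} (hΩ : volume Ω ≠ ⊤)
    (hlim : ∀ (x : Rn n) (ε : ℝ), Tendsto (fun k => ∫ y in Metric.ball x ε, w k y) atTop (𝓝 0)) :
    Tendsto (fun k => ∫⁻ x in Ω, ‖w k x‖ₑ) atTop (𝓝 0) := by
  set κ := volume (Metric.ball (0 : Rn n) 1) with hκ
  have hκ0 : κ ≠ 0 := (Metric.measure_ball_pos _ _ one_pos).ne'
  have hκt : κ ≠ ⊤ := measure_ball_lt_top.ne
  have hI : ∀ ε : ℝ, Tendsto (fun k => ∫⁻ x in Ω, ‖∫ y in Metric.ball x ε, w k y‖ₑ) atTop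
      (𝓝 0) := by
    intro ε
    have := tendsto_lintegral_of_dominated_convergence' (μ := volume.restrict Ω)
      (F := fun k x => ‖∫ y in Metric.ball x ε, w k y‖ₑ) (f := fun _ => 0)
      (fun _ => ENNReal.ofReal A)
      (fun k => (aestronglyMeasurable_ballIntegral (hw k).1 ε).enorm.mono_measure
        Measure.restrict_le_self)
      (fun k => Eventually.of_forall fun x => ?_) ?_ (Eventually.of_forall fun x => ?_)
    · simpa using this
    · beta_reduce
      rw [← ofReal_norm]
      refine ENNReal.ofReal_le_ofReal ((norm_integral_le_integral_norm _).trans ?_)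
      exact (setIntegral_le_integral (hw k).norm (Eventually.of_forall fun _ => norm_nonneg _)).trans
        (hA k)
    · simpa using ENNReal.mul_ne_top ENNReal.ofReal_ne_top hΩ
    · simpa using (hlim x ε).enorm
  have hbound : ∀ ε : ℝ, 0 < ε → ∀ k, ∫⁻ x in Ω, ‖w k x‖ₑ ≤
      ENNReal.ofReal (ε ^ s) * (volume Ω + E / κ) +
        (∫⁻ x in Ω, ‖∫ y in Metric.ball x ε, w k y‖ₑ) / volume (Metric.ball (0 : Rn n) ε) := by
    intro ε hε k
    have hm0 : volume (Metric.ball (0 : Rn n) ε) ≠ 0 := (Metric.measure_ball_pos _ _ hε).ne'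
    have hmt : volume (Metric.ball (0 : Rn n) ε) ≠ ⊤ := measure_ball_lt_top.ne
    have h := lintegral_enorm_le hs (hw k) Ω hε
    have hmε : volume (Metric.ball (0 : Rn n) ε) = ENNReal.ofReal (ε ^ n) * κ := by
      rw [Measure.addHaar_ball_of_pos _ _ hε, finrank_euclideanSpace_fin]
    have hsplit : ENNReal.ofReal (ε ^ ((n : ℝ) + s)) * E =
        volume (Metric.ball (0 : Rn n) ε) * (ENNReal.ofReal (ε ^ s) * (E / κ)) := by
      rw [hmε, Real.rpow_add hε, Real.rpow_natCast, ENNReal.ofReal_mul (by positivity)]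
      calc _ = ENNReal.ofReal (ε ^ n) * ENNReal.ofReal (ε ^ s) * (κ * (E / κ)) := by
            rw [ENNReal.mul_div_cancel hκ0 hκt]
        _ = _ := by ring
    rw [mul_comm, ← ENNReal.le_div_iff_mul_le (Or.inl hm0) (Or.inl hmt)] at h
    refine h.trans ?_
    rw [ENNReal.add_div]
    refine add_le_add_left ?_ _
    refine ENNReal.div_le_of_le_mul' ?_
    calc _ ≤ ENNReal.ofReal (ε ^ s) * volume (Metric.ball (0 : Rn n) ε) * volume Ω +
        ENNReal.ofReal (ε ^ ((n : ℝ) + s)) * E := by gcongr; exact hwE k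
      _ = _ := by rw [hsplit]; ring
  rw [ENNReal.tendsto_nhds_zero]
  intro η hη
  have hη2 : 0 < η / 2 := ENNReal.half_pos hη.ne'
  obtain ⟨ε, hε, hεη⟩ : ∃ ε : ℝ, 0 < ε ∧
      ENNReal.ofReal (ε ^ s) * (volume Ω + E / κ) ≤ η / 2 := by
    have h1 : Tendsto (fun ε : ℝ => ENNReal.ofReal (ε ^ s) * (volume Ω + E / κ)) (𝓝[>] 0)
        (𝓝 0) := by
      have h2 : Tendsto (fun ε : ℝ => ε ^ s) (𝓝[>] 0) (𝓝 0) := by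
        have := (Real.continuousAt_rpow_const 0 s (Or.inr hs.le)).tendsto
        rw [Real.zero_rpow hs.ne'] at this
        exact this.mono_left nhdsWithin_le_nhds
      have := ENNReal.Tendsto.mul_const (b := volume Ω + E / κ) (ENNReal.tendsto_ofReal h2)
        (Or.inr (ENNReal.add_ne_top.2 ⟨hΩ, ENNReal.div_ne_top hE hκ0⟩))
      simpa using this
    obtain ⟨ε, h2, h3⟩ := ((ENNReal.tendsto_nhds_zero.1 h1 _ hη2).and self_mem_nhdsWithin).exists
    exact ⟨ε, h3, h2⟩
  have h1 : Tendsto (fun k => (∫⁻ x in Ω, ‖∫ y in Metric.ball x ε, w k y‖ₑ) /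
      volume (Metric.ball (0 : Rn n) ε)) atTop (𝓝 0) := by
    have := ENNReal.Tendsto.div_const (b := volume (Metric.ball (0 : Rn n) ε)) (hI ε)
      (Or.inr (Metric.measure_ball_pos _ _ hε).ne')
    simpa using this
  filter_upwards [ENNReal.tendsto_nhds_zero.1 h1 _ hη2] with k hk
  calc _ ≤ _ := hbound ε hε k
    _ ≤ η / 2 + η / 2 := add_le_add hεη hk
    _ = η := ENNReal.add_halves η

/-- The compact embedding `X̃ → L¹(Ω)`. -/
theorem WeaklyConverges.tendsto_lintegral_enorm {n : ℕ} {s : ℝ} (hs : 0 < s) {K : Rn n → ℝ}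
    {hK : IsKernel s K} {Ω : Set (Rn n)} (hΩ : volume Ω ≠ ⊤)
    {uk : ℕ → XTilde hK Ω} {u : XTilde hK Ω} (h : WeaklyConverges hK Ω uk u) :
    Tendsto (fun k => ∫⁻ x in Ω, ‖(uk k : Rn n → ℝ) x - (u : Rn n → ℝ) x‖ₑ) atTop (𝓝 0) := by
  have : IsFiniteMeasure (volume.restrict Ω) := ⟨by simpa using hΩ.lt_top⟩
  obtain ⟨c, hc, hcB⟩ := exists_gagliardo_le hK Ω
  obtain ⟨B, hB⟩ := h.exists_norm_le (jumpL2 hK Ω) (norm_jumpL2_le hK)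
  obtain ⟨B', hB'⟩ := h.exists_norm_le (restrictL2 hK Ω) (norm_restrictL2_le hK)
  have hone : MemLp (fun _ : Rn n => (1 : ℝ)) 2 (volume.restrict Ω) := memLp_const 1
  have hzero : ∀ (w : XTilde hK Ω) (x : Rn n), x ∉ Ω → (w : Rn n → ℝ) x = 0 := fun w => w.2.2
  have hintΩ : ∀ w : XTilde hK Ω, IntegrableOn (w : Rn n → ℝ) Ω := fun w =>
    w.2.1.memLp.integrable one_le_two
  have hint : ∀ w : XTilde hK Ω, Integrable (w : Rn n → ℝ) := fun w =>
    (integrableOn_iff_integrable_of_support_subset fun x hx => by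
      by_contra hxΩ
      exact hx (hzero w x hxΩ)).1 (hintΩ w)
  refine tendsto_lintegral_enorm_zero (w := fun k => ((uk k - u : XTilde hK Ω) : Rn n → ℝ)) hs
    (fun k => hint _) (A := (‖restrictL2 hK Ω u‖ + B') * ‖hone.toLp _‖) (fun k => ?_)
    (E := ENNReal.ofReal ((B + ‖jumpL2 hK Ω u‖) ^ 2 / c)) ENNReal.ofReal_ne_top
    (fun k => hcB _ _ ?_) hΩ (fun x ε => ?_)
  · have habs : MemLp (fun x => ‖((uk k - u : XTilde hK Ω) : Rn n → ℝ) x‖) 2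
        (volume.restrict Ω) := (uk k - u).2.1.memLp.norm
    have e1 : ∫ x, ‖((uk k - u : XTilde hK Ω) : Rn n → ℝ) x‖ =
        inner ℝ (habs.toLp _) (hone.toLp _) := by
      rw [inner_toLp_toLp, ← setIntegral_eq_integral_of_forall_compl_eq_zero (s := Ω)
        fun x hx => by rw [hzero _ x hx, norm_zero]]
      simp
    rw [e1]
    refine (real_inner_le_norm _ _).trans ?_
    gcongr
    have e2 : ‖habs.toLp _‖ = ‖restrictL2 hK Ω (uk k - u)‖ := by
      rw [← sq_eq_sq₀ (norm_nonneg _) (norm_nonneg _), norm_toLp_sq]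
      have : ‖restrictL2 hK Ω (uk k - u)‖ ^ 2 = _ := norm_toLp_sq (uk k - u).2.1.memLp
      rw [this]
      simp only [Real.norm_eq_abs, sq_abs]
    rw [e2, map_sub, add_comm]
    exact (norm_sub_le _ _).trans (add_le_add_left (hB' k) _)
  · rw [map_sub]
    exact (norm_sub_le _ _).trans (add_le_add_left (hB k) _)
  · have hind : MemLp ((Metric.ball x ε).indicator fun _ => (1 : ℝ)) 2 (volume.restrict Ω) :=
      hone.indicator measurableSet_ball
    have e1 : ∀ w : XTilde hK Ω, inner ℝ (hind.toLp _) (restrictL2 hK Ω w) =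
        ∫ y in Metric.ball x ε, (w : Rn n → ℝ) y := by
      intro w
      have : inner ℝ (hind.toLp _) (restrictL2 hK Ω w) = _ := inner_toLp_toLp hind w.2.1.memLp
      rw [this, setIntegral_eq_integral_of_forall_compl_eq_zero fun y hy => by
        rw [hzero w y hy, mul_zero], ← integral_indicator measurableSet_ball]
      congr 1
      funext y
      by_cases hy : y ∈ Metric.ball x ε <;> simp [hy]
    have h1 := (h.tendsto_inner (restrictL2 hK Ω) (norm_restrictL2_le hK) (hind.toLp _)).sub_const
      (inner ℝ (hind.toLp _) (restrictL2 hK Ω u))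
    rw [sub_self] at h1
    refine h1.congr fun k => ?_
    rw [← inner_sub_right, ← map_sub, e1]

/-! ### Stability of the bounds on the controls -/

section Control

variable {n : ℕ} {Ω : Set (Rn n)}

theorem continuousOn_prod_univ_of_tendstoUniformlyOn (hΩ : IsOpen Ω) {gk : ℕ → Rn n → ℝ → ℝ}
    {g : Rn n → ℝ → ℝ}
    (hgk : ∀ k, ContinuousOn (fun p : Rn n × ℝ => gk k p.1 p.2) (Ω ×ˢ univ))
    (hg : ∀ M : ℝ, 0 < M → TendstoUniformlyOn (fun k (p : Rn n × ℝ) => gk k p.1 p.2)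
      (fun p => g p.1 p.2) atTop (Ω ×ˢ Ioo (-M) M)) :
    ContinuousOn (fun p : Rn n × ℝ => g p.1 p.2) (Ω ×ˢ univ) := by
  rintro ⟨x, t⟩ ⟨hx, -⟩
  have ht : t ∈ Ioo (-(|t| + 1)) (|t| + 1) := abs_lt.1 (by linarith)
  have hc := (hg (|t| + 1) (by positivity)).continuousOn (Frequently.of_forall fun k =>
    (hgk k).mono (prod_mono subset_rfl (subset_univ _)))
  exact (hc.continuousAt ((hΩ.prod isOpen_Ioo).mem_nhds ⟨hx, ht⟩)).continuousWithinAt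

theorem SobolevBound.of_tendstoUniformlyOn (hΩ : IsOpen Ω) (hΩb : Bornology.IsBounded Ω)
    {r : ℝ} (hr : 2 ≤ r) {C : ℝ → ℝ} {gk : ℕ → Rn n → ℝ → ℝ} {g : Rn n → ℝ → ℝ}
    (hgk : ∀ k, SobolevBound Ω r C (gk k))
    (hg : ∀ M : ℝ, 0 < M → TendstoUniformlyOn (fun k (p : Rn n × ℝ) => gk k p.1 p.2)
      (fun p => g p.1 p.2) atTop (Ω ×ˢ Ioo (-M) M)) : SobolevBound Ω r C g := by
  have hc := continuousOn_prod_univ_of_tendstoUniformlyOn hΩ (fun k => (hgk k).continuousOn) hg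
  refine ⟨hc, fun M hM => ?_⟩
  have hV : MeasurableSet (Ω ×ˢ Ioo (-M) M) := (hΩ.prod isOpen_Ioo).measurableSet
  have hfin : volume (Ω ×ˢ Ioo (-M) M) ≠ ⊤ := by
    rw [Measure.volume_eq_prod, Measure.prod_prod]
    exact ENNReal.mul_ne_top hΩb.measure_lt_top.ne measure_Ioo_lt_top.ne
  exact SobolevNormLE.of_tendstoUniformlyOn hr hV hfin (fun k => (hgk k).norm_le M hM)
    ((hc.mono (prod_mono subset_rfl (subset_univ _))).aestronglyMeasurable hV) (hg M hM)

theorem GrowthBound.of_tendstoUniformlyOn {a₁ a₂ q : ℝ} {gk : ℕ → Rn n → ℝ → ℝ}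
    {g : Rn n → ℝ → ℝ} (hgk : ∀ k, GrowthBound Ω a₁ a₂ q (gk k))
    (hg : ∀ M : ℝ, 0 < M → TendstoUniformlyOn (fun k (p : Rn n × ℝ) => gk k p.1 p.2)
      (fun p => g p.1 p.2) atTop (Ω ×ˢ Ioo (-M) M)) : GrowthBound Ω a₁ a₂ q g := by
  intro x hx t
  have ht : t ∈ Ioo (-(|t| + 1)) (|t| + 1) := abs_lt.1 (by linarith)
  have h := (hg (|t| + 1) (by positivity)).tendsto_at (x := (x, t)) ⟨hx, ht⟩
  exact le_of_tendsto' h.abs fun k => hgk k x hx t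

/-! ### The nonlinear term -/

theorem aestronglyMeasurable_comp (hΩ : MeasurableSet Ω) {g : Rn n → ℝ → ℝ}
    (hg : ContinuousOn (fun p : Rn n × ℝ => g p.1 p.2) (Ω ×ˢ univ)) {u : Rn n → ℝ}
    (hu : AEStronglyMeasurable u (volume.restrict Ω)) :
    AEStronglyMeasurable (fun x => g x (u x)) (volume.restrict Ω) := by
  classical
  have hm : Measurable ((Ω ×ˢ (univ : Set ℝ)).piecewise (fun p : Rn n × ℝ => g p.1 p.2) 0) :=
    hg.measurable_piecewise continuousOn_const (hΩ.prod MeasurableSet.univ)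
  have h := (hm.comp_aemeasurable (aemeasurable_id.prodMk hu.aemeasurable)).aestronglyMeasurable
  refine h.congr ?_
  filter_upwards [ae_restrict_mem hΩ] with x hx
  exact piecewise_eq_of_mem _ _ _ (show (x, u x) ∈ Ω ×ˢ (univ : Set ℝ) from ⟨hx, mem_univ _⟩)

/-- The superposition operator maps bounded sets of `L^q(Ω)` to bounded sets of `L^{q'}(Ω)`,
`q' = q / (q - 1)`. -/
theorem GrowthBound.eLpNorm_comp_le (hΩ : MeasurableSet Ω) {a₁ a₂ q : ℝ}
    (ha₂ : 0 ≤ a₂) (hq : 1 < q) {g : Rn n → ℝ → ℝ} (hg : GrowthBound Ω a₁ a₂ q g)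
    {u : Rn n → ℝ} (hu : AEStronglyMeasurable u (volume.restrict Ω)) :
    eLpNorm (fun x => g x (u x)) (ENNReal.ofReal (q / (q - 1))) (volume.restrict Ω) ≤
      eLpNorm (fun _ => a₁) (ENNReal.ofReal (q / (q - 1))) (volume.restrict Ω) +
        ENNReal.ofReal a₂ *
          eLpNorm u (ENNReal.ofReal q) (volume.restrict Ω) ^ (q - 1) := by
  have hq1 : 0 < q - 1 := by linarith
  have hq' : (1 : ℝ≥0∞) ≤ ENNReal.ofReal (q / (q - 1)) := by
    rw [← ENNReal.ofReal_one]
    refine ENNReal.ofReal_le_ofReal ?_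
    rw [le_div_iff₀ hq1]
    linarith
  have hpow : AEStronglyMeasurable (fun x => ‖u x‖ ^ (q - 1)) (volume.restrict Ω) :=
    (Real.continuous_rpow_const hq1.le).comp_aestronglyMeasurable hu.norm
  calc eLpNorm (fun x => g x (u x)) (ENNReal.ofReal (q / (q - 1))) (volume.restrict Ω)
      ≤ eLpNorm ((fun _ => a₁) + a₂ • fun x => ‖u x‖ ^ (q - 1)) (ENNReal.ofReal (q / (q - 1)))
        (volume.restrict Ω) := by
        refine eLpNorm_mono_ae_real ?_
        filter_upwards [ae_restrict_mem hΩ] with x hx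
        exact hg x hx (u x)
    _ ≤ _ := eLpNorm_add_le aestronglyMeasurable_const (hpow.const_smul a₂) hq'
    _ = _ := by
      rw [eLpNorm_const_smul, eLpNorm_norm_rpow _ hq1, ← ENNReal.ofReal_mul (by positivity),
        div_mul_cancel₀ _ hq1.ne', Real.enorm_of_nonneg ha₂]

/-- Products of a bounded sequence in `L^{p'}` with a fixed function in `L^p` are uniformly
integrable. -/
theorem unifIntegrable_mul {α : Type*} [MeasurableSpace α] {μ : Measure α} {p p' : ℝ}
    (hp : p'.HolderConjugate p) {f : ℕ → α → ℝ} {v : α → ℝ}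
    (hf : ∀ k, AEStronglyMeasurable (f k) μ) {B : ℝ≥0∞} (hB : B ≠ ⊤)
    (hfB : ∀ k, eLpNorm (f k) (ENNReal.ofReal p') μ ≤ B) (hv : MemLp v (ENNReal.ofReal p) μ) :
    UnifIntegrable (fun k x => f k x * v x) 1 μ := by
  have := hp.ennrealOfReal
  intro ε hε
  have hp1 : (1 : ℝ≥0∞) ≤ ENNReal.ofReal p := by
    rw [← ENNReal.ofReal_one]
    exact ENNReal.ofReal_le_ofReal hp.symm.lt.le
  obtain ⟨δ, hδ, h⟩ := hv.eLpNorm_indicator_le hp1 ENNReal.ofReal_ne_top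
    (ε := ε / (B.toReal + 1)) (by positivity)
  refine ⟨δ, hδ, fun k s hs hμs => ?_⟩
  have e1 : s.indicator (fun x => f k x * v x) = f k • s.indicator v := by
    funext x
    by_cases hx : x ∈ s <;> simp [hx]
  change eLpNorm (s.indicator (fun x => f k x * v x)) 1 μ ≤ _
  rw [e1]
  calc eLpNorm (f k • s.indicator v) 1 μ
      ≤ eLpNorm (f k) (ENNReal.ofReal p') μ * eLpNorm (s.indicator v) (ENNReal.ofReal p) μ :=
        eLpNorm_smul_le_mul_eLpNorm (hv.1.indicator hs) (hf k)
    _ ≤ B * ENNReal.ofReal (ε / (B.toReal + 1)) := by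
      gcongr
      exacts [hfB k, h s hs hμs]
    _ ≤ ENNReal.ofReal ε := by
      rw [← ENNReal.ofReal_toReal hB, ← ENNReal.ofReal_mul ENNReal.toReal_nonneg,
        ENNReal.toReal_ofReal ENNReal.toReal_nonneg]
      refine ENNReal.ofReal_le_ofReal ?_
      have : 0 ≤ B.toReal := ENNReal.toReal_nonneg
      rw [← mul_div_assoc, div_le_iff₀ (by positivity)]
      nlinarith

/-- Convergence of the nonlinear term along a sequence that is bounded in `L^q(Ω)` and converges
almost everywhere. -/
theorem tendsto_integral_comp_mul (hΩ : IsOpen Ω) (hΩb : Bornology.IsBounded Ω)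
    {a₁ a₂ q : ℝ} (ha₂ : 0 ≤ a₂) (hq : 1 < q) {gk : ℕ → Rn n → ℝ → ℝ}
    {g : Rn n → ℝ → ℝ}
    (hgk : ∀ k, ContinuousOn (fun p : Rn n × ℝ => gk k p.1 p.2) (Ω ×ˢ univ))
    (hgrowth : ∀ k, GrowthBound Ω a₁ a₂ q (gk k))
    (hg : ∀ M : ℝ, 0 < M → TendstoUniformlyOn (fun k (p : Rn n × ℝ) => gk k p.1 p.2)
      (fun p => g p.1 p.2) atTop (Ω ×ˢ Ioo (-M) M))
    {uk : ℕ → Rn n → ℝ} {u v : Rn n → ℝ} {S : ℝ≥0∞} (hS : S ≠ ⊤)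
    (huk : ∀ k, AEStronglyMeasurable (uk k) (volume.restrict Ω))
    (hukS : ∀ k, eLpNorm (uk k) (ENNReal.ofReal q) (volume.restrict Ω) ≤ S)
    (hu : MemLp u (ENNReal.ofReal q) (volume.restrict Ω))
    (hv : MemLp v (ENNReal.ofReal q) (volume.restrict Ω))
    (hlim : ∀ᵐ x ∂volume.restrict Ω, Tendsto (fun k => uk k x) atTop (𝓝 (u x))) :
    IntegrableOn (fun x => g x (u x) * v x) Ω ∧
      Tendsto (fun k => ∫ x in Ω, gk k x (uk k x) * v x) atTop
        (𝓝 (∫ x in Ω, g x (u x) * v x)) := by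
  have hΩfin : volume Ω ≠ ⊤ := hΩb.measure_lt_top.ne
  have : IsFiniteMeasure (volume.restrict Ω) := ⟨by simpa using hΩfin.lt_top⟩
  have hq1 : 0 < q - 1 := by linarith
  have hconj : (q / (q - 1)).HolderConjugate q := (Real.HolderConjugate.conjExponent hq).symm
  have := hconj.ennrealOfReal
  have hc := continuousOn_prod_univ_of_tendstoUniformlyOn hΩ hgk hg
  have hgr := GrowthBound.of_tendstoUniformlyOn hgrowth hg
  have hconst : eLpNorm (fun _ => a₁) (ENNReal.ofReal (q / (q - 1))) (volume.restrict Ω) ≠ ⊤ :=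
    (memLp_const a₁).2.ne
  have hbd : ∀ T : ℝ≥0∞, T ≠ ⊤ →
      eLpNorm (fun _ => a₁) (ENNReal.ofReal (q / (q - 1))) (volume.restrict Ω) +
        ENNReal.ofReal a₂ * T ^ (q - 1) ≠ ⊤ := fun T hT =>
    ENNReal.add_ne_top.2 ⟨hconst, ENNReal.mul_ne_top ENNReal.ofReal_ne_top
      (ENNReal.rpow_ne_top_of_nonneg hq1.le hT)⟩
  have hmk : ∀ k, AEStronglyMeasurable (fun x => gk k x (uk k x)) (volume.restrict Ω) := fun k =>
    aestronglyMeasurable_comp hΩ.measurableSet (hgk k) (huk k)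
  have hgu : MemLp (fun x => g x (u x)) (ENNReal.ofReal (q / (q - 1))) (volume.restrict Ω) :=
    ⟨aestronglyMeasurable_comp hΩ.measurableSet hc hu.1,
      (hgr.eLpNorm_comp_le hΩ.measurableSet ha₂ hq hu.1).trans_lt (hbd _ hu.2.ne).lt_top⟩
  have hmem : MemLp (fun x => g x (u x) * v x) 1 (volume.restrict Ω) := hv.smul hgu
  have hui := unifIntegrable_mul hconj hmk (hbd S hS) (fun k =>
    ((hgrowth k).eLpNorm_comp_le hΩ.measurableSet ha₂ hq (huk k)).trans (by
      gcongr
      exact hukS k)) hv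
  have hae : ∀ᵐ x ∂volume.restrict Ω, Tendsto (fun k => gk k x (uk k x) * v x) atTop
      (𝓝 (g x (u x) * v x)) := by
    filter_upwards [hlim, ae_restrict_mem hΩ.measurableSet] with x hx hxΩ
    refine Tendsto.mul_const _ ?_
    have ht : u x ∈ Ioo (-(|u x| + 1)) (|u x| + 1) := abs_lt.1 (by linarith)
    have hopen : Ω ×ˢ Ioo (-(|u x| + 1)) (|u x| + 1) ∈ 𝓝 (x, u x) :=
      (hΩ.prod isOpen_Ioo).mem_nhds ⟨hxΩ, ht⟩
    refine (hg (|u x| + 1) (by positivity)).tendsto_comp (x := (x, u x))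
      (g := fun k => (x, uk k x)) ?_ ?_
    · exact (hc _ ⟨hxΩ, mem_univ _⟩).mono (prod_mono subset_rfl (subset_univ _))
    · rw [nhdsWithin_eq_nhds.2 hopen]
      exact tendsto_const_nhds.prodMk_nhds hx
  have hmk' : ∀ k, AEStronglyMeasurable (fun x => gk k x (uk k x) * v x) (volume.restrict Ω) :=
    fun k => (hmk k).mul hv.1
  have hint : IntegrableOn (fun x => g x (u x) * v x) Ω := memLp_one_iff_integrable.1 hmem
  have hLp := tendsto_Lp_finite_of_tendsto_ae le_rfl ENNReal.one_ne_top hmk' hmem hui hae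
  refine ⟨hint, tendsto_integral_of_L1' _ hint.1 (Eventually.of_forall fun k => ?_) hLp⟩
  have h1 : MemLp (fun x => gk k x (uk k x)) (ENNReal.ofReal (q / (q - 1))) (volume.restrict Ω) :=
    ⟨hmk k, (((hgrowth k).eLpNorm_comp_le hΩ.measurableSet ha₂ hq (huk k)).trans (by
      gcongr
      exact hukS k)).trans_lt (hbd S hS).lt_top⟩
  exact memLp_one_iff_integrable.1 (hv.smul h1)

end Control

end FracControl

open FracControl
theorem mainTheorem4 {n : ℕ} (hn : 2 < n) {s : ℝ} (hs : s ∈ Set.Ioo (0 : ℝ) 1)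
    {K : Rn n → ℝ} (hK : IsKernel s K)
    {Ω : Set (Rn n)} (hΩo : IsOpen Ω) (hΩb : Bornology.IsBounded Ω)
    {a₁ a₂ μ r q : ℝ} (ha₁ : 0 < a₁) (ha₂ : 0 < a₂) (hμ : 2 < μ) (hr : (n : ℝ) + 1 < r)
    (hq : q ∈ Set.Ioo (2 : ℝ) (2 * n / (n - 2 * s)))
    {C : ℝ → ℝ} (hC : ∀ M : ℝ, 0 < M → 0 < C M)
    (gk : ℕ → Rn n → ℝ → ℝ) (g : Rn n → ℝ → ℝ)
    (hg : ∀ M : ℝ, 0 < M →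
      TendstoUniformlyOn (fun k (p : Rn n × ℝ) => gk k p.1 p.2) (fun p => g p.1 p.2)
        Filter.atTop (Ω ×ˢ Set.Ioo (-M) M))
    (uk : ℕ → XTilde hK Ω) (u : XTilde hK Ω)
    (hsol : ∀ k, (uk k, gk k) ∈ admissiblePairs hK Ω a₁ a₂ μ r q C)
    (hu : WeaklyConverges hK Ω uk u) :
    (∀ v : XTilde hK Ω,
      Integrable (fun p : Rn n × Rn n =>
        K (p.1 - p.2) * ((u : Rn n → ℝ) p.1 - (u : Rn n → ℝ) p.2) *
          ((v : Rn n → ℝ) p.1 - (v : Rn n → ℝ) p.2)) ∧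
      IntegrableOn (fun x => g x ((u : Rn n → ℝ) x) * (v : Rn n → ℝ) x) Ω ∧
      energyDeriv K Ω g u v = 0) ∧
    SobolevBound Ω r C g ∧ GrowthBound Ω a₁ a₂ q g ∧
    (SuperlinearAtZero Ω g → AmbrosettiRabinowitz Ω μ g →
      (u, g) ∈ admissiblePairs hK Ω a₁ a₂ μ r q C) := by
  have hn3 : (3 : ℝ) ≤ n := by exact_mod_cast hn
  have hsn : 2 * s < n := by linarith [hs.2]
  have hΩfin : volume Ω ≠ ⊤ := hΩb.measure_lt_top.ne
  have hcont : ∀ k, ContinuousOn (fun p : Rn n × ℝ => gk k p.1 p.2) (Ω ×ˢ univ) := fun k =>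
    (hsol k).1.1.continuousOn
  have hgrowth : ∀ k, GrowthBound Ω a₁ a₂ q (gk k) := fun k => (hsol k).1.2.1
  have hSob : SobolevBound Ω r C g :=
    SobolevBound.of_tendstoUniformlyOn hΩo hΩb (by linarith) (fun k => (hsol k).1.1) hg
  have hGrow : GrowthBound Ω a₁ a₂ q g := GrowthBound.of_tendstoUniformlyOn hgrowth hg
  have hLq := exists_eLpNorm_le (by omega) hs.1 hsn hK hΩfin
    (by linarith [hq.1] : (0 : ℝ) < q) hq.2
  have hmem : ∀ w : XTilde hK Ω,
      MemLp (w : Rn n → ℝ) (ENNReal.ofReal q) (volume.restrict Ω) := fun w => by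
    obtain ⟨S, hS, h⟩ := hLq ‖jumpL2 hK Ω w‖
    exact ⟨w.2.1.memLp.1, (h w le_rfl).trans_lt hS.lt_top⟩
  obtain ⟨B, hB⟩ := hu.exists_norm_le (jumpL2 hK Ω) (norm_jumpL2_le hK)
  obtain ⟨S, hS, hSB⟩ := hLq B
  -- strong `L¹` convergence gives almost everywhere convergence of a subsequence, which suffices
  -- because the bilinear term converges along the whole sequence
  obtain ⟨ns, hns, hae⟩ : ∃ ns : ℕ → ℕ, StrictMono ns ∧ ∀ᵐ x ∂volume.restrict Ω,
      Tendsto (fun k => (uk (ns k) : Rn n → ℝ) x) atTop (𝓝 ((u : Rn n → ℝ) x)) := by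
    refine (tendstoInMeasure_of_tendsto_eLpNorm one_ne_zero (fun k => (uk k).2.1.memLp.1)
      u.2.1.memLp.1 ?_).exists_seq_tendsto_ae
    simp only [eLpNorm_one_eq_lintegral_enorm]
    exact hu.tendsto_lintegral_enorm hs.1 hΩfin
  have hsolution : ∀ v : XTilde hK Ω,
      IntegrableOn (fun x => g x ((u : Rn n → ℝ) x) * (v : Rn n → ℝ) x) Ω ∧
      energyDeriv K Ω g u v = 0 := by
    intro v
    obtain ⟨hint, hlim⟩ := tendsto_integral_comp_mul hΩo hΩb ha₂.le
      (by linarith [hq.1] : 1 < q) (fun k => hcont (ns k)) (fun k => hgrowth (ns k))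
      (fun M hM t ht => hns.tendsto_atTop.eventually (hg M hM t ht)) hS
      (fun k => (uk (ns k)).2.1.memLp.1) (fun k => hSB _ (hB _)) (hmem u) (hmem v) hae
    refine ⟨hint, ?_⟩
    have h1 := (hu.tendsto_inner (jumpL2 hK Ω) (norm_jumpL2_le hK) (jumpL2 hK Ω v)).comp
      hns.tendsto_atTop
    simp only [Function.comp_def, inner_jumpL2] at h1
    have h2 := h1.sub hlim
    have h3 : ∀ k, energyDeriv K Ω (gk (ns k)) (uk (ns k)) v = 0 := fun k => (hsol (ns k)).2 v
    simp only [energyDeriv] at h3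
    simp only [h3] at h2
    exact tendsto_nhds_unique h2 tendsto_const_nhds
  exact ⟨fun v => ⟨integrable_energy hK u v, hsolution v⟩, hSob, hGrow,
    fun h3 h4 => ⟨⟨hSob, hGrow, h3, h4⟩, fun v => (hsolution v).2⟩⟩
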